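/- Let $k$ be a field and $n\ge 1$ an integer. "Algebra" means associative algebra with unit. An $n$-dimensional algebra $A$ over a commutative ring $R$ has degree of algebraicity $\le d$ if the morphism of $R$-schemes $A\to\wedge^{d+1}A$, $a\mapsto 1\wedge a\wedge a^2\wedge\dots\wedge a^d$, is zero, i.e. if it vanishes on $A\otimes_R R'$ for every commutative $R$-algebra $R'$. Let $\mathrm{Alg}_n$ be the affine $k$-scheme of finite type whose $R$-points are the $n$-dimensional $R$-algebras with a basis, that is, the unital associative algebra structures on $R^n$, described by structure constants $c^{ij}_r$ with $e_ie_j=\sum_r c^{ij}_re_r$ and the coordinates of the unit. Let $\mathrm{Alg}_n^1\subset\mathrm{Alg}_n$ be the closed subscheme given by the condition $e_1=1$. For $X=\mathrm{Alg}_n$ or $X=\mathrm{Alg}_n^1$, let $X_{\le d}\subset X$ be the closed subset of points $x$ such that the algebra over the residue field $\kappa(x)$ has degree of algebraicity $\le d$, and let $X_{d}=X_{\le d}\setminus X_{\le d-1}$. Then: 1. $X_{n}$ is irreducible; its (Krull) dimension is $n^2$ if $X=\mathrm{Alg}_n$, and $n^2-n$ if $X=\mathrm{Alg}_n^1$. 2.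 The closure $\overline{X_{n}}$ is an irreducible component of $X$. 3. $X_{\le n-1}$ is a union of irreducible components of $X$ (an empty union being allowed). -/

import Mathlib

open scoped TensorProduct

universe u

/-- A structure of unital associative `R`-algebra on the free module `R ^ n` with its standard
basis `e_i`: structure constants `c i j r` with `e_i e_j = ∑ r, c i j r • e_r`, and the
coordinates `one r` of the unit element. These are the `R`-points of the scheme of based
`n`-dimensional algebras. -/
structure AlgStr (n : ℕ) (R : Type u) [CommRing R] where
  c : Fin n → Fin n → Fin n → R
  one : Fin n → R
  /-- `(e_i e_j) e_l = e_i (e_j e_l)` -/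
  assoc : ∀ i j l r, ∑ m, c i j m * c m l r = ∑ m, c j l m * c i m r
  /-- `1 e_j = e_j` -/
  unit_mul : ∀ j r, ∑ m, one m * c m j r = if j = r then 1 else 0
  /-- `e_j 1 = e_j` -/
  mul_unit : ∀ j r, ∑ m, one m * c j m r = if j = r then 1 else 0

namespace AlgStr

variable {n : ℕ} {R : Type u} [CommRing R]

/-- The `R`-algebra defined by the structure constants; its underlying module is `R ^ n`. -/
def Carrier (_ : AlgStr n R) : Type u := Fin n → R

instance (s : AlgStr n R) : AddCommGroup s.Carrier := inferInstanceAs (AddCommGroup (Fin n → R))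

instance (s : AlgStr n R) : Module R s.Carrier := inferInstanceAs (Module R (Fin n → R))

instance (s : AlgStr n R) : One s.Carrier := ⟨s.one⟩

instance (s : AlgStr n R) : Mul s.Carrier := ⟨fun a b r => ∑ i, ∑ j, a i * b j * s.c i j r⟩

theorem carrier_mul_apply (s : AlgStr n R) (a b : s.Carrier) (r : Fin n) :
    (a * b) r = ∑ i, ∑ j, a i * b j * s.c i j r := rfl

theorem carrier_one_apply (s : AlgStr n R) (r : Fin n) : (1 : s.Carrier) r = s.one r := rfl

theorem carrier_add_apply (s : AlgStr n R) (a b : s.Carrier) (r : Fin n) :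
    (a + b) r = a r + b r := rfl

theorem carrier_zero_apply (s : AlgStr n R) (r : Fin n) : (0 : s.Carrier) r = 0 := rfl

theorem carrier_smul_apply (s : AlgStr n R) (x : R) (a : s.Carrier) (r : Fin n) :
    (x • a) r = x * a r := rfl

theorem carrier_one_mul (s : AlgStr n R) (a : s.Carrier) : 1 * a = a := by
  funext r
  rw [carrier_mul_apply, Finset.sum_comm]
  have h : ∀ j, ∑ i, (1 : s.Carrier) i * a j * s.c i j r = a j * if j = r then 1 else 0 := by
    intro j
    rw [← s.unit_mul j r, Finset.mul_sum]
    refine Finset.sum_congr rfl fun m _ => ?_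
    rw [carrier_one_apply]; ring
  simp only [h, mul_ite, mul_one, mul_zero]
  exact (Finset.sum_ite_eq' Finset.univ r a).trans (if_pos (Finset.mem_univ r))

theorem carrier_mul_one (s : AlgStr n R) (a : s.Carrier) : a * 1 = a := by
  funext r
  rw [carrier_mul_apply]
  have h : ∀ i, ∑ j, a i * (1 : s.Carrier) j * s.c i j r = a i * if i = r then 1 else 0 := by
    intro j
    rw [← s.mul_unit j r, Finset.mul_sum]
    refine Finset.sum_congr rfl fun m _ => ?_
    rw [carrier_one_apply]; ring
  simp only [h, mul_ite, mul_one, mul_zero]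
  exact (Finset.sum_ite_eq' Finset.univ r a).trans (if_pos (Finset.mem_univ r))

theorem carrier_mul_assoc (s : AlgStr n R) (x y z : s.Carrier) : x * y * z = x * (y * z) := by
  funext r
  have hl : (x * y * z) r
      = ∑ i, ∑ j, ∑ l, x i * y j * z l * ∑ m, s.c i j m * s.c m l r := by
    simp only [carrier_mul_apply, Finset.sum_mul, Finset.mul_sum]
    calc _ = ∑ m, ∑ i, ∑ l, ∑ j, x i * y j * s.c i j m * z l * s.c m l r :=
          Finset.sum_congr rfl fun m _ => Finset.sum_comm
      _ = ∑ i, ∑ m, ∑ j, ∑ l, x i * y j * s.c i j m * z l * s.c m l r := by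
          rw [Finset.sum_comm]
          exact Finset.sum_congr rfl fun i _ => Finset.sum_congr rfl fun m _ => Finset.sum_comm
      _ = ∑ i, ∑ j, ∑ l, ∑ m, x i * y j * s.c i j m * z l * s.c m l r := by
          refine Finset.sum_congr rfl fun i _ => ?_
          rw [Finset.sum_comm]
          exact Finset.sum_congr rfl fun j _ => Finset.sum_comm
      _ = _ := by
          refine Finset.sum_congr rfl fun i _ => Finset.sum_congr rfl fun j _ =>
            Finset.sum_congr rfl fun l _ => Finset.sum_congr rfl fun m _ => by ring
  have hr : (x * (y * z)) r
      = ∑ i, ∑ j, ∑ l, x i * y j * z l * ∑ m, s.c j l m * s.c i m r := by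
    simp only [carrier_mul_apply, Finset.sum_mul, Finset.mul_sum]
    refine Finset.sum_congr rfl fun i _ => ?_
    rw [Finset.sum_comm]
    refine Finset.sum_congr rfl fun j _ => ?_
    rw [Finset.sum_comm]
    exact Finset.sum_congr rfl fun l _ => Finset.sum_congr rfl fun m _ => by ring
  rw [hl, hr]
  simp only [s.assoc]

instance (s : AlgStr n R) : Ring s.Carrier :=
  { (inferInstance : AddCommGroup s.Carrier) with
    left_distrib := fun a b c => by
      funext r
      simp only [carrier_mul_apply, carrier_add_apply, mul_add, add_mul, Finset.sum_add_distrib]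
    right_distrib := fun a b c => by
      funext r
      simp only [carrier_mul_apply, carrier_add_apply, add_mul, Finset.sum_add_distrib]
    zero_mul := fun a => by
      funext r
      simp [carrier_mul_apply, carrier_zero_apply]
    mul_zero := fun a => by
      funext r
      simp [carrier_mul_apply, carrier_zero_apply]
    mul_assoc := s.carrier_mul_assoc
    one_mul := s.carrier_one_mul
    mul_one := s.carrier_mul_one }

instance (s : AlgStr n R) : Algebra R s.Carrier :=
  Algebra.ofModule
    (fun x a b => by
      funext r
      simp only [carrier_mul_apply, carrier_smul_apply, Finset.mul_sum, mul_assoc])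
    (fun x a b => by
      funext r
      simp only [carrier_mul_apply, carrier_smul_apply, Finset.mul_sum]
      exact Finset.sum_congr rfl fun i _ => Finset.sum_congr rfl fun j _ => by ring)

/-- Base change of an algebra structure along a ring homomorphism. -/
def map (s : AlgStr n R) {S : Type u} [CommRing S] (φ : R →+* S) : AlgStr n S where
  c i j r := φ (s.c i j r)
  one r := φ (s.one r)
  assoc i j l r := by simpa using congrArg φ (s.assoc i j l r)
  unit_mul j r := by simpa [apply_ite φ] using congrArg φ (s.unit_mul j r)
  mul_unit j r := by simpa [apply_ite φ] using congrArg φ (s.mul_unit j r)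

end AlgStr

/-- The degree of algebraicity of the `R`-algebra `A` is at most `d`: the morphism of schemes
`A → ⋀^(d+1) A`, `a ↦ 1 ∧ a ∧ ⋯ ∧ a ^ d`, is zero, that is, it is zero on `R'`-points for every
commutative `R`-algebra `R'`. -/
def DegAlgLE (R : Type u) [CommRing R] (A : Type u) [Ring A] [Algebra R A] (d : ℕ) : Prop :=
  ∀ (R' : Type u) [CommRing R'] [Algebra R R'] (a : R' ⊗[R] A),
    exteriorPower.ιMulti R' (d + 1) (fun j : Fin (d + 1) => a ^ (j : ℕ)) = 0

namespace AlgStr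

variable {n : ℕ} {R : Type u} [CommRing R]

/-- For an `n`-dimensional based algebra over `Spec R`, the set of points of `Spec R` over which
the fibre (an algebra over the residue field) has degree of algebraicity at most `d`. -/
def degLE (s : AlgStr n R) (d : ℕ) : Set (PrimeSpectrum R) :=
  {p | DegAlgLE p.asIdeal.ResidueField
    (s.map (algebraMap R p.asIdeal.ResidueField)).Carrier d}

/-- For `d ≥ 1`, the set of points of `Spec R` over which the fibre has degree of algebraicity
exactly `d`. -/
def degEq (s : AlgStr n R) (d : ℕ) : Set (PrimeSpectrum R) :=
  s.degLE d \ s.degLE (d - 1)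

end AlgStr

section Moduli

variable (k : Type u) [Field k] (n : ℕ)

/-- Coordinates on the space of tables: `Sum.inl (i, j, r)` for `c i j r`, `Sum.inr r` for the
`r`-th coordinate of the unit. -/
abbrev AlgVar : Type := (Fin n × Fin n × Fin n) ⊕ Fin n

/-- The generic structure constant. -/
noncomputable def genC (i j r : Fin n) : MvPolynomial (AlgVar n) k :=
  MvPolynomial.X (Sum.inl (i, j, r))

/-- The generic coordinate of the unit. -/
noncomputable def genOne (r : Fin n) : MvPolynomial (AlgVar n) k :=
  MvPolynomial.X (Sum.inr r)

/-- The relations of associativity and of the unit. -/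
def algRel : Set (MvPolynomial (AlgVar n) k) :=
  {f | ∃ i j l r, f = ∑ m, genC k n i j m * genC k n m l r - ∑ m, genC k n j l m * genC k n i m r}
  ∪ {f | ∃ j r, f = ∑ m, genOne k n m * genC k n m j r - if j = r then 1 else 0}
  ∪ {f | ∃ j r, f = ∑ m, genOne k n m * genC k n j m r - if j = r then 1 else 0}

/-- The relations saying that the unit is the first basis vector. -/
def firstRel [NeZero n] : Set (MvPolynomial (AlgVar n) k) :=
  {f | ∃ r, f = genOne k n r - if r = 0 then 1 else 0}

/-- Coordinate ring of the scheme of unital associative algebras of dimension `n` with a basis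
(equivalently: of unital associative algebra structures on a fixed module of rank `n`). -/
abbrev BasedAlgRing : Type u := MvPolynomial (AlgVar n) k ⧸ Ideal.span (algRel k n)

/-- Coordinate ring of the scheme of unital associative algebras of dimension `n` with a basis
whose first vector is the unit. -/
abbrev PointedAlgRing [NeZero n] : Type u :=
  MvPolynomial (AlgVar n) k ⧸ Ideal.span (algRel k n ∪ firstRel k n)

/-- An algebra structure over any quotient of the polynomial ring in which the relations hold. -/
noncomputable def tautStr (I : Ideal (MvPolynomial (AlgVar n) k)) (hI : algRel k n ⊆ I) :
    AlgStr n (MvPolynomial (AlgVar n) k ⧸ I) where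
  c i j r := Ideal.Quotient.mk I (genC k n i j r)
  one r := Ideal.Quotient.mk I (genOne k n r)
  assoc i j l r := by
    have := Ideal.Quotient.eq.2 (hI (Or.inl (Or.inl ⟨i, j, l, r, rfl⟩)))
    simpa using this
  unit_mul j r := by
    have := Ideal.Quotient.eq.2 (hI (Or.inl (Or.inr ⟨j, r, rfl⟩)))
    simpa [apply_ite (Ideal.Quotient.mk I)] using this
  mul_unit j r := by
    have := Ideal.Quotient.eq.2 (hI (Or.inr ⟨j, r, rfl⟩))
    simpa [apply_ite (Ideal.Quotient.mk I)] using this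

/-- The universal algebra with a basis. -/
noncomputable def basedUniv : AlgStr n (BasedAlgRing k n) :=
  tautStr k n _ Ideal.subset_span

/-- The universal algebra with a basis whose first vector is the unit. -/
noncomputable def pointedUniv [NeZero n] : AlgStr n (PointedAlgRing k n) :=
  tautStr k n _ (Set.subset_union_left.trans Ideal.subset_span)

end Moduli

/-!
Let `U` be the universal algebra over `Spec Q`, for either of the two moduli schemes. The polynomial
law `a ↦ 1 ∧ a ∧ ⋯ ∧ a ^ (n - 1)` on an `n`-dimensional based algebra is a single polynomial
`AlgStr.genDet`, the determinant of the powers of the generic element. The locus `X_{≤ n-1}` is the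
zero locus of its coefficients, and `X_n` is the open complement (`AlgStr.mem_degLE_pred_iff`,
`AlgStr.mem_degEq_rank_iff`).

**Irreducibility.** A based algebra with a generator `a` is the same thing as an invertible matrix,
whose `j`-th column holds the coordinates of `a ^ j`, and a vector of coefficients expressing `a ^ n`
by the lower powers (`AlgStr.exists_powMatrix_eq`, `AlgStr.eq_of_powMatrix_eq`). So based algebras
with a generator are parametrized by a localized polynomial ring (`ParamRing`). Every point `p` of
`X_n` is a specialization of the image of the generic point of this parameter space, because after
adjoining `n` indeterminates to the residue field at `p`, the generic element is a generator
(`IsParam.paramPoint_le`). As `X_n` is open and irreducible, its closure is a component.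

**Dimension.** For `n ≥ 2`, requiring that the generator be `e_2` cuts the parameter space down to
one with `n ^ 2` variables, or `n ^ 2 - n` if `e_1 = 1` is imposed. It is embedded in `X_n`
(`IsParam.lift_surjective`) and has a rational point, the identity matrix, which gives a chain of
the expected length; and it dominates `X_n` (`IsParam.closure_degEq_eq`), so the coordinate ring of
the closure of `X_n` is a subring of a localized polynomial ring, and Noether normalization and
transcendence degrees give the upper bound. For `n = 1` the generator `0` plays the role of `e_2`.

**Components of `X_{≤ n-1}`.** The algebras parametrized by the closure of `X_n` are commutative. It
suffices that each point `x` of `X_{≤ n-1}` is a specialization of a point with a noncommutative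
algebra: a component through the latter contains `x` and cannot meet `X_n`. If the algebra `A` at
`x`, over an algebraic closure of the residue field, is commutative, then it is not generated by one
element, and some cotangent space has dimension at least two (`exists_linearIndependent_pow`). Then
`a * b + t l(a) D(b)` is a noncommutative associative deformation of `A` over the affine line, where
`l` is a tangent vector at that point and `D` a derivation into the socle
(`exists_isNoncommDeformation`, `AlgStr.exists_noncomm_deformation`).
-/

/-! ### Powers of elements in coordinates -/

namespace AlgStr

variable {n : ℕ} {R : Type u} [CommRing R]

theorem eq_of_c_eq_of_one_eq {s t : AlgStr n R} (hc : s.c = t.c) (h1 : s.one = t.one) : s = t := by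
  cases s; cases t; simp_all

theorem map_map (s : AlgStr n R) {S T : Type u} [CommRing S] [CommRing T] (φ : R →+* S)
    (ψ : S →+* T) : (s.map φ).map ψ = s.map (ψ.comp φ) := rfl

/-- Base change of elements along a ring homomorphism. -/
def mapHom (s : AlgStr n R) {S : Type u} [CommRing S] (φ : R →+* S) :
    s.Carrier →+* (s.map φ).Carrier where
  toFun a := fun i => φ (a i)
  map_one' := rfl
  map_zero' := by
    funext r
    exact map_zero φ
  map_add' a b := by
    funext r
    exact map_add φ _ _
  map_mul' a b := by
    funext r
    simp only [carrier_mul_apply, map_sum, map_mul]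
    rfl

/-- The coordinates of the `j`-th power of the element with coordinates `a`. -/
def powCoord (s : AlgStr n R) (a : Fin n → R) (j : ℕ) : Fin n → R :=
  ((show s.Carrier from a) ^ j : s.Carrier)

theorem powCoord_zero (s : AlgStr n R) (a : Fin n → R) : s.powCoord a 0 = s.one :=
  pow_zero (show s.Carrier from a)

theorem powCoord_one (s : AlgStr n R) (a : Fin n → R) : s.powCoord a 1 = a :=
  pow_one (show s.Carrier from a)

theorem powCoord_map (s : AlgStr n R) {S : Type u} [CommRing S] (φ : R →+* S) (a : Fin n → R)
    (j : ℕ) : (s.map φ).powCoord (fun i => φ (a i)) j = fun i => φ (s.powCoord a j i) :=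
  (map_pow (s.mapHom φ) (show s.Carrier from a) j).symm

/-- The matrix whose `j`-th column holds the coordinates of `a ^ j`, for `j < n`. -/
def powMatrix (s : AlgStr n R) (a : Fin n → R) : Matrix (Fin n) (Fin n) R :=
  Matrix.of fun i j => s.powCoord a j i

theorem powMatrix_apply (s : AlgStr n R) (a : Fin n → R) (i j : Fin n) :
    s.powMatrix a i j = s.powCoord a j i := rfl

theorem powMatrix_map (s : AlgStr n R) {S : Type u} [CommRing S] (φ : R →+* S) (a : Fin n → R) :
    (s.map φ).powMatrix (fun i => φ (a i)) = (s.powMatrix a).map φ := by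
  ext i j
  simp [powMatrix_apply, powCoord_map]

theorem det_powMatrix_map (s : AlgStr n R) {S : Type u} [CommRing S] (φ : R →+* S)
    (a : Fin n → R) :
    ((s.map φ).powMatrix (fun i => φ (a i))).det = φ (s.powMatrix a).det := by
  rw [powMatrix_map, ← RingHom.mapMatrix_apply, ← RingHom.map_det]

/-- The determinant of the powers `1, t, …, t ^ (n - 1)` of the generic element
`t = ∑ i, X i • e_i`: up to the choice of a basis of the target, this is the polynomial law
`a ↦ 1 ∧ a ∧ ⋯ ∧ a ^ (n - 1)`. -/
noncomputable def genDet (s : AlgStr n R) : MvPolynomial (Fin n) R :=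
  ((s.map MvPolynomial.C).powMatrix MvPolynomial.X).det

theorem eval₂_genDet (s : AlgStr n R) {S : Type u} [CommRing S] (φ : R →+* S) (a : Fin n → S) :
    MvPolynomial.eval₂Hom φ a s.genDet = ((s.map φ).powMatrix a).det := by
  rw [genDet, ← det_powMatrix_map, map_map]
  congr 2
  · congr 1
    ext r
    simp
  · funext i
    simp

theorem genDet_map (s : AlgStr n R) {S : Type u} [CommRing S] (φ : R →+* S) :
    (s.map φ).genDet = MvPolynomial.map φ s.genDet := by
  rw [genDet, map_map, ← eval₂_genDet]
  refine congrArg (fun f : MvPolynomial (Fin n) R →+* MvPolynomial (Fin n) S => f s.genDet) ?_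
  ext <;> simp

theorem genDet_eq_zero_iff (s : AlgStr n R) :
    s.genDet = 0 ↔ ∀ (S : Type u) [CommRing S] (φ : R →+* S) (a : Fin n → S),
      ((s.map φ).powMatrix a).det = 0 := by
  refine ⟨fun h S _ φ a => ?_, fun h => h _ _ _⟩
  rw [← eval₂_genDet, h, map_zero]

/-! ### Structure constants of an algebra with a basis -/

section OfBasis

variable {B : Type*} [Ring B] [Algebra R B] (b : Module.Basis (Fin n) R B)

theorem repr_mul_left (x y : B) (r : Fin n) :
    b.repr (x * y) r = ∑ i, b.repr x i * b.repr (b i * y) r := by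
  conv_lhs => rw [← b.sum_repr x, Finset.sum_mul, map_sum, Finsupp.finsetSum_apply]
  exact Finset.sum_congr rfl fun i _ => by rw [smul_mul_assoc, map_smul]; rfl

theorem repr_mul_right (x y : B) (r : Fin n) :
    b.repr (x * y) r = ∑ i, b.repr y i * b.repr (x * b i) r := by
  conv_lhs => rw [← b.sum_repr y, Finset.mul_sum, map_sum, Finsupp.finsetSum_apply]
  exact Finset.sum_congr rfl fun i _ => by rw [mul_smul_comm, map_smul]; rfl

/-- The structure constants of an algebra with respect to a basis. -/
noncomputable def ofBasis : AlgStr n R where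
  c i j r := b.repr (b i * b j) r
  one r := b.repr 1 r
  assoc i j l r := by
    rw [← repr_mul_left, ← repr_mul_right, mul_assoc]
  unit_mul j r := by
    rw [← repr_mul_left, one_mul, b.repr_self, Finsupp.single_apply]
  mul_unit j r := by
    rw [← repr_mul_right, mul_one, b.repr_self, Finsupp.single_apply]

/-- Taking coordinates is an isomorphism from an algebra with a basis to the algebra defined by
its structure constants. -/
noncomputable def ofBasisEquiv : B ≃+* (ofBasis b).Carrier where
  toEquiv := b.equivFun.toEquiv
  map_add' := b.equivFun.map_add
  map_mul' x y := by
    funext r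
    change b.repr (x * y) r = ∑ i, ∑ j, b.repr x i * b.repr y j * b.repr (b i * b j) r
    rw [repr_mul_left]
    refine Finset.sum_congr rfl fun i _ => ?_
    rw [repr_mul_right, Finset.mul_sum]
    exact Finset.sum_congr rfl fun j _ => by ring

theorem ofBasis_powCoord (x : B) (j : ℕ) :
    (ofBasis b).powCoord (b.equivFun x) j = b.equivFun (x ^ j) :=
  (map_pow (ofBasisEquiv b) x j).symm

theorem det_powMatrix_ofBasis (x : B) :
    ((ofBasis b).powMatrix (b.equivFun x)).det = b.det fun j : Fin n => x ^ (j : ℕ) := by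
  rw [Module.Basis.det_apply]
  congr 1
  ext i j
  rw [powMatrix_apply, ofBasis_powCoord]
  rfl

/-- The exterior product of the powers of `x` is the top form of a basis, multiplied by the
determinant of the powers. -/
theorem ιMulti_pow_eq_zero_iff (x : B) :
    exteriorPower.ιMulti R n (fun j : Fin n => x ^ (j : ℕ)) = 0 ↔
      ((ofBasis b).powMatrix (b.equivFun x)).det = 0 := by
  rw [det_powMatrix_ofBasis]
  constructor
  · intro h
    have := exteriorPower.alternatingMapLinearEquiv_apply_ιMulti b.det
      (fun j : Fin n => x ^ (j : ℕ))
    rw [← this, h, map_zero]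
  · intro h
    have key : exteriorPower.ιMulti R n (M := B) =
        (LinearMap.toSpanSingleton R (⋀[R]^n B) (exteriorPower.ιMulti R n b)).compAlternatingMap
          b.det := by
      refine Module.Basis.ext_alternating b fun v hv => ?_
      let σ : Equiv.Perm (Fin n) := Equiv.ofBijective v (Finite.injective_iff_bijective.1 hv)
      change exteriorPower.ιMulti R n (b ∘ σ) = b.det (b ∘ σ) • exteriorPower.ιMulti R n b
      simp only [AlternatingMap.map_perm, Module.Basis.det_self]
      rw [smul_assoc, one_smul]
    rw [key]
    change b.det (fun j : Fin n => x ^ (j : ℕ)) • exteriorPower.ιMulti R n b = 0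
    rw [h, zero_smul]

end OfBasis

/-! ### The degree of algebraicity in coordinates -/

/-- The standard basis of the algebra defined by structure constants. -/
noncomputable def stdBasis (s : AlgStr n R) : Module.Basis (Fin n) R s.Carrier :=
  Module.Basis.ofEquivFun
    { toFun := fun a : s.Carrier => (a : Fin n → R)
      invFun := fun a => a
      left_inv := fun _ => rfl
      right_inv := fun _ => rfl
      map_add' := fun _ _ => rfl
      map_smul' := fun _ _ => rfl }

theorem stdBasis_repr (s : AlgStr n R) (a : s.Carrier) (i : Fin n) :
    s.stdBasis.repr a i = a i := rfl

theorem stdBasis_apply (s : AlgStr n R) (i r : Fin n) :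
    s.stdBasis i r = if i = r then 1 else 0 := by
  rw [← s.stdBasis_repr (s.stdBasis i) r, Module.Basis.repr_self, Finsupp.single_apply]

theorem stdBasis_mul_apply (s : AlgStr n R) (i j r : Fin n) :
    (s.stdBasis i * s.stdBasis j : s.Carrier) r = s.c i j r := by
  rw [carrier_mul_apply]
  simp [stdBasis_apply]

/-- Base change of structure constants is base change of the algebra. -/
theorem ofBasis_baseChange (s : AlgStr n R) (S : Type u) [CommRing S] [Algebra R S] :
    ofBasis (Algebra.TensorProduct.basis S s.stdBasis) = s.map (algebraMap R S) := by
  refine eq_of_c_eq_of_one_eq ?_ ?_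
  · funext i j r
    change (Algebra.TensorProduct.basis S s.stdBasis).repr _ r = algebraMap R S (s.c i j r)
    rw [Algebra.TensorProduct.basis_apply, Algebra.TensorProduct.basis_apply,
      Algebra.TensorProduct.tmul_mul_tmul, Algebra.TensorProduct.basis_repr_tmul, mul_one,
      one_smul, Finsupp.mapRange_apply, stdBasis_repr, stdBasis_mul_apply]
  · funext r
    change (Algebra.TensorProduct.basis S s.stdBasis).repr _ r = algebraMap R S (s.one r)
    rw [Algebra.TensorProduct.one_def, Algebra.TensorProduct.basis_repr_tmul,
      one_smul, Finsupp.mapRange_apply, stdBasis_repr]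
    rfl

/-- A polynomial law vanishes if and only if it vanishes at the generic element. -/
theorem degAlgLE_iff_genDet_eq_zero [NeZero n] (s : AlgStr n R) :
    DegAlgLE R s.Carrier (n - 1) ↔ s.genDet = 0 := by
  have aux : ∀ (m : ℕ) (_ : m = n) (S : Type u) [CommRing S] [Algebra R S]
      (x : S ⊗[R] s.Carrier), exteriorPower.ιMulti S m (fun j : Fin m => x ^ (j : ℕ)) = 0 ↔
        ((s.map (algebraMap R S)).powMatrix
          ((Algebra.TensorProduct.basis S s.stdBasis).equivFun x)).det = 0 := by
    rintro m rfl S _ _ x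
    rw [← ofBasis_baseChange]
    exact ιMulti_pow_eq_zero_iff _ x
  have hn : n - 1 + 1 = n := Nat.succ_pred_eq_of_ne_zero (NeZero.ne n)
  rw [genDet_eq_zero_iff]
  constructor
  · intro h S _ φ a
    let _ := φ.toAlgebra
    have := (aux _ hn S _).1 (h S ((Algebra.TensorProduct.basis S s.stdBasis).equivFun.symm a))
    rwa [LinearEquiv.apply_symm_apply] at this
  · intro h S _ _ x
    exact (aux _ hn S x).2 (h S _ _)

theorem degAlgLE_rank (s : AlgStr n R) : DegAlgLE R s.Carrier n := by
  intro S _ _ x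
  have : exteriorPower.ιMulti S (n + 1) (M := S ⊗[R] s.Carrier) = 0 := by
    refine Module.Basis.ext_alternating (Algebra.TensorProduct.basis S s.stdBasis) fun v hv => ?_
    simpa using Fintype.card_le_of_injective v hv
  rw [this]
  rfl

theorem degLE_rank (s : AlgStr n R) : s.degLE n = Set.univ :=
  Set.eq_univ_of_forall fun _ => degAlgLE_rank _

theorem mem_degLE_pred_iff [NeZero n] (s : AlgStr n R) (p : PrimeSpectrum R) :
    p ∈ s.degLE (n - 1) ↔ ∀ m, s.genDet.coeff m ∈ p.asIdeal := by
  change DegAlgLE _ _ _ ↔ _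
  rw [degAlgLE_iff_genDet_eq_zero, genDet_map, MvPolynomial.ext_iff]
  simp [MvPolynomial.coeff_map, Ideal.algebraMap_residueField_eq_zero]

theorem mem_degEq_rank_iff [NeZero n] (s : AlgStr n R) (p : PrimeSpectrum R) :
    p ∈ s.degEq n ↔ p ∉ s.degLE (n - 1) := by
  simp [degEq, degLE_rank]

theorem degEq_rank_eq_compl [NeZero n] (s : AlgStr n R) : s.degEq n = (s.degLE (n - 1))ᶜ :=
  Set.ext s.mem_degEq_rank_iff

theorem isClosed_degLE_pred [NeZero n] (s : AlgStr n R) : IsClosed (s.degLE (n - 1)) := by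
  have : s.degLE (n - 1) = PrimeSpectrum.zeroLocus (Set.range fun m => s.genDet.coeff m) := by
    ext p
    rw [mem_degLE_pred_iff, PrimeSpectrum.mem_zeroLocus, Set.range_subset_iff]
    rfl
  rw [this]
  exact PrimeSpectrum.isClosed_zeroLocus _

theorem mem_degLE_pred_of_ker_iff [NeZero n] (s : AlgStr n R) {S : Type u} [CommRing S]
    (φ : R →+* S) (p : PrimeSpectrum R) (hp : p.asIdeal = RingHom.ker φ) :
    p ∈ s.degLE (n - 1) ↔ (s.map φ).genDet = 0 := by
  rw [mem_degLE_pred_iff, genDet_map, MvPolynomial.ext_iff]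
  simp [MvPolynomial.coeff_map, hp, RingHom.mem_ker]

/-- A point of the spectrum lies in the open set of algebras of maximal degree of algebraicity as
soon as one element of the algebra it parametrizes has independent powers. -/
theorem mem_degEq_rank_of_det_ne_zero [NeZero n] (s : AlgStr n R) {S : Type u} [CommRing S]
    (φ : R →+* S) (p : PrimeSpectrum R) (hp : p.asIdeal = RingHom.ker φ) (a : Fin n → S)
    (ha : ((s.map φ).powMatrix a).det ≠ 0) : p ∈ s.degEq n := by
  rw [mem_degEq_rank_iff, mem_degLE_pred_of_ker_iff s φ p hp]
  intro h
  rw [genDet_eq_zero_iff] at h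
  exact ha (h S (RingHom.id S) a)

end AlgStr

namespace AlgStr

variable {n : ℕ} {R : Type u} [CommRing R]

/-! ### Algebras generated by one element -/

theorem carrier_sum_apply (s : AlgStr n R) {ι : Type*} (t : Finset ι) (f : ι → s.Carrier)
    (r : Fin n) : (∑ i ∈ t, f i) r = ∑ i ∈ t, f i r := by
  simp only [← stdBasis_repr, map_sum, Finsupp.finsetSum_apply]

/-- Structure constants in terms of the powers of a generator: if `G` is inverse to the matrix of
the powers of `a`, then `e_i = ∑ k, G k i • a ^ k`. -/
theorem c_eq_sum_powCoord (s : AlgStr n R) (a : Fin n → R) (G : Matrix (Fin n) (Fin n) R)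
    (hG : s.powMatrix a * G = 1) (i j r : Fin n) :
    s.c i j r = ∑ k, ∑ l, G k i * G l j * s.powCoord a (k + l) r := by
  have he : ∀ i, s.stdBasis i = ∑ k, G k i • ((show s.Carrier from a) ^ (k : ℕ) : s.Carrier) := by
    intro i
    funext r
    rw [stdBasis_apply, carrier_sum_apply]
    have := congrFun (congrFun hG r) i
    rw [Matrix.mul_apply, Matrix.one_apply] at this
    simp only [eq_comm (a := i), ← this, carrier_smul_apply, mul_comm (G _ i)]
    rfl
  rw [← stdBasis_mul_apply, he i, he j, Finset.sum_mul_sum, carrier_sum_apply]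
  refine Finset.sum_congr rfl fun k _ => ?_
  rw [carrier_sum_apply]
  refine Finset.sum_congr rfl fun l _ => ?_
  rw [smul_mul_smul_comm, ← pow_add, carrier_smul_apply]
  rfl

/-- The linear recursion satisfied by the coordinates of the powers of a generator. -/
theorem powCoord_add_rank (s : AlgStr n R) (a f : Fin n → R)
    (hf : s.powCoord a n = (s.powMatrix a).mulVec f) (m : ℕ) (r : Fin n) :
    s.powCoord a (m + n) r = ∑ j : Fin n, f j * s.powCoord a (m + j) r := by
  have h : ((show s.Carrier from a) ^ n : s.Carrier) =
      ∑ j : Fin n, f j • ((show s.Carrier from a) ^ (j : ℕ) : s.Carrier) := by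
    funext r
    rw [carrier_sum_apply]
    have := congrFun hf r
    rw [Matrix.mulVec, dotProduct] at this
    exact this.trans (Finset.sum_congr rfl fun j _ => mul_comm _ _)
  change ((show s.Carrier from a) ^ (m + n) : s.Carrier) r = _
  rw [pow_add, h, Finset.mul_sum, carrier_sum_apply]
  refine Finset.sum_congr rfl fun j _ => ?_
  rw [mul_smul_comm, ← pow_add]
  rfl

/-- A based algebra generated by one element is determined by the coordinates of the first `n`
powers of the generator. -/
theorem eq_of_powMatrix_eq [NeZero n] {s t : AlgStr n R} {a b : Fin n → R}
    (hM : s.powMatrix a = t.powMatrix b) (hdet : IsUnit (s.powMatrix a).det)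
    (hn : s.powCoord a n = t.powCoord b n) : s = t := by
  have hG := Matrix.mul_nonsing_inv _ hdet
  set G := (s.powMatrix a)⁻¹
  have hs : s.powCoord a n = (s.powMatrix a).mulVec (G.mulVec (s.powCoord a n)) := by
    rw [Matrix.mulVec_mulVec, hG, Matrix.one_mulVec]
  have ht : t.powCoord b n = (t.powMatrix b).mulVec (G.mulVec (s.powCoord a n)) := by
    rw [← hn, ← hM, ← hs]
  have hpow : ∀ m, s.powCoord a m = t.powCoord b m := by
    intro m
    induction m using Nat.strong_induction_on with
    | _ m ih =>
      by_cases hm : m < n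
      · funext i
        exact congrFun (congrFun hM i) ⟨m, hm⟩
      · obtain ⟨m, rfl⟩ := Nat.exists_eq_add_of_le' (not_lt.1 hm)
        funext r
        rw [powCoord_add_rank s a _ hs, powCoord_add_rank t b _ ht]
        exact Finset.sum_congr rfl fun j _ => by rw [ih (m + j) (by omega)]
  refine eq_of_c_eq_of_one_eq ?_ ?_
  · funext i j r
    rw [c_eq_sum_powCoord s a G hG, c_eq_sum_powCoord t b G (hM ▸ hG)]
    simp only [hpow]
  · rw [← s.powCoord_zero a, ← t.powCoord_zero b, hpow]

open Polynomial in
/-- The algebra `R[x] / (x ^ n - ∑ f_j x ^ j)`, with a basis in which `x ^ j` has the `j`-th column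
of a given invertible matrix as coordinates. -/
theorem exists_powMatrix_eq [Nontrivial R] (H : Matrix (Fin n) (Fin n) R) (hH : IsUnit H.det)
    (f : Fin n → R) :
    ∃ (s : AlgStr n R) (a : Fin n → R), s.powMatrix a = H ∧ s.powCoord a n = H.mulVec f ∧
      ∀ i j, s.c i j = s.c j i := by
  set q : R[X] := ∑ j : Fin n, C (f j) * X ^ (j : ℕ) with hq
  have hqd : q.degree < (X ^ n : R[X]).degree := by
    rw [degree_X_pow]
    exact degree_sum_fin_lt f
  have hg : (X ^ n - q).Monic := (monic_X_pow n).sub_of_left hqd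
  have hd : (X ^ n - q).natDegree = n :=
    natDegree_eq_of_degree_eq_some ((degree_sub_eq_left_of_degree_lt hqd).trans (degree_X_pow n))
  have hroot : AdjoinRoot.root (X ^ n - q) ^ n =
      ∑ j : Fin n, f j • AdjoinRoot.root (X ^ n - q) ^ (j : ℕ) := by
    have h0 : aeval (AdjoinRoot.root (X ^ n - q)) (X ^ n - q) = 0 := by
      rw [AdjoinRoot.aeval_eq, AdjoinRoot.mk_self]
    simpa [hq, sub_eq_zero, Algebra.smul_def] using h0
  let pb : Module.Basis (Fin n) R (AdjoinRoot (X ^ n - q)) :=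
    (AdjoinRoot.powerBasis' hg).basis.reindex (finCongr hd)
  have hpb : ∀ j : Fin n, pb j = AdjoinRoot.root (X ^ n - q) ^ (j : ℕ) := by
    intro j
    rw [Module.Basis.reindex_apply, PowerBasis.basis_eq_pow]
    rfl
  let b : Module.Basis (Fin n) R (AdjoinRoot (X ^ n - q)) := Module.Basis.ofEquivFun
    (pb.equivFun ≪≫ₗ
      Matrix.toLin'OfInv (Matrix.nonsing_inv_mul H hH) (Matrix.mul_nonsing_inv H hH))
  have hb : ∀ x, b.equivFun x = H.mulVec (pb.equivFun x) := by
    intro x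
    change b.equivFun x = Matrix.toLin' H (pb.equivFun x)
    rw [Module.Basis.equivFun_ofEquivFun]
    rfl
  refine ⟨ofBasis b, b.equivFun (AdjoinRoot.root (X ^ n - q)), ?_, ?_, ?_⟩
  · ext i j
    rw [powMatrix_apply, ofBasis_powCoord, hb, ← hpb, Matrix.mulVec, dotProduct]
    simp only [Module.Basis.equivFun_self, mul_ite, mul_one, mul_zero, Finset.sum_ite_eq,
      Finset.mem_univ, if_true]
  · rw [ofBasis_powCoord, hb, hroot]
    simp only [← hpb]
    congr 1
    exact pb.equivFun_apply _ ▸ pb.repr_sum_self f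
  · intro i j
    funext r
    change b.repr _ r = b.repr _ r
    rw [mul_comm]

end AlgStr

/-! ### Linear algebra: operators with small eigenspaces -/

section LinearAlgebra

variable {K V : Type*} [Field K] [AddCommGroup V] [Module K V] [FiniteDimensional K V]

theorem finrank_ker_mul_le (f g : Module.End K V) :
    Module.finrank K (LinearMap.ker (f * g)) ≤
      Module.finrank K (LinearMap.ker f) + Module.finrank K (LinearMap.ker g) := by
  have hmaps : ∀ x : LinearMap.ker (f * g), (g.domRestrict _ x) ∈ LinearMap.ker f := fun x => x.2
  rw [← ((g.domRestrict (LinearMap.ker (f * g))).codRestrict _ hmaps).finrank_range_add_finrank_ker]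
  refine add_le_add (Submodule.finrank_le _) ?_
  let i : LinearMap.ker ((g.domRestrict (LinearMap.ker (f * g))).codRestrict _ hmaps) →ₗ[K]
      LinearMap.ker g :=
    ((LinearMap.ker (f * g)).subtype ∘ₗ Submodule.subtype _).codRestrict _ fun x => by
      have := x.2
      rw [LinearMap.mem_ker] at this
      exact congrArg Subtype.val this
  refine LinearMap.finrank_le_finrank_of_injective (f := i) fun x y h => ?_
  exact Subtype.ext (Subtype.ext (congrArg (fun z : LinearMap.ker g => (z : V)) h))

/-- If all eigenspaces of `T` are at most one-dimensional, then a polynomial in `T` with `m` roots has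
a kernel of dimension at most `m`. -/
theorem finrank_ker_prod_le (T : Module.End K V)
    (hT : ∀ c : K, Module.finrank K (LinearMap.ker (T - algebraMap K _ c)) ≤ 1) (s : Multiset K) :
    Module.finrank K (LinearMap.ker (Polynomial.aeval T
      (s.map fun c => Polynomial.X - Polynomial.C c).prod)) ≤ Multiset.card s := by
  induction s using Multiset.induction_on with
  | empty =>
    rw [Multiset.map_zero, Multiset.prod_zero, map_one, Module.End.one_eq_id, LinearMap.ker_id,
      finrank_bot]
    exact zero_le
  | cons c s ih =>
    rw [Multiset.map_cons, Multiset.prod_cons, map_mul, Multiset.card_cons, add_comm]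
    refine (finrank_ker_mul_le _ _).trans (add_le_add ?_ ih)
    rw [map_sub, Polynomial.aeval_X, Polynomial.aeval_C]
    exact hT c

end LinearAlgebra

/-! ### Finite-dimensional commutative algebras which are not monogenic -/

section Commutative

variable {K A : Type*} [Field K] [IsAlgClosed K] [CommRing A] [Algebra K A] [FiniteDimensional K A]

/-- If the quotients `A / (a - c)` are at most one-dimensional, then the minimal polynomial of `a`
has the largest possible degree. -/
theorem finrank_le_natDegree_minpoly (a : A)
    (ha : ∀ c : K, Module.finrank K (A ⧸ Ideal.span {a - algebraMap K A c}) ≤ 1) :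
    Module.finrank K A ≤ (minpoly K a).natDegree := by
  have hint : IsIntegral K a := Algebra.IsIntegral.isIntegral a
  have hsplit := IsAlgClosed.splits (minpoly K a)
  have hprod := hsplit.eq_prod_roots_of_monic (minpoly.monic hint)
  have hker : ∀ c : K,
      Module.finrank K (LinearMap.ker (Algebra.lmul K A a - algebraMap K _ c)) ≤ 1 := by
    intro c
    have h1 : Algebra.lmul K A a - algebraMap K _ c = Algebra.lmul K A (a - algebraMap K A c) := by
      rw [map_sub, AlgHom.commutes]
    rw [h1]
    have h2 := (Algebra.lmul K A (a - algebraMap K A c)).finrank_range_add_finrank_ker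
    have h3 := Submodule.finrank_quotient_add_finrank
      ((Ideal.span {a - algebraMap K A c}).restrictScalars K)
    have h4 : LinearMap.range (Algebra.lmul K A (a - algebraMap K A c)) =
        (Ideal.span {a - algebraMap K A c}).restrictScalars K := by
      ext x
      simp only [LinearMap.mem_range, Algebra.coe_lmul_eq_mul, LinearMap.mul_apply',
        Submodule.restrictScalars_mem, Ideal.mem_span_singleton', mul_comm]
    have h5 : Module.finrank K (A ⧸ (Ideal.span {a - algebraMap K A c}).restrictScalars K) ≤ 1 :=
      ha c
    rw [h4] at h2
    omega
  have h := finrank_ker_prod_le _ hker (minpoly K a).roots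
  rw [← hprod, Polynomial.aeval_algHom_apply, minpoly.aeval, map_zero, LinearMap.ker_zero,
    finrank_top] at h
  exact h.trans (Polynomial.card_roots' _)

theorem exists_algHom_ker_eq (M : Ideal A) [M.IsMaximal] :
    ∃ ε : A →ₐ[K] K, RingHom.ker ε = M := by
  let _ := Ideal.Quotient.field M
  have hb : Function.Bijective (algebraMap K (A ⧸ M)) :=
    IsAlgClosed.algebraMap_bijective_of_isIntegral
  refine ⟨(AlgEquiv.ofBijective (Algebra.ofId K (A ⧸ M)) hb).symm.toAlgHom.comp
    (Ideal.Quotient.mkₐ K M), ?_⟩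
  ext x
  simp [RingHom.mem_ker, Ideal.Quotient.eq_zero_iff_mem]

/-- A commutative algebra whose cotangent spaces at all maximal ideals are at most
one-dimensional is generated by one element. -/
theorem exists_linearIndependent_pow
    (h : ∀ M : Ideal A, M.IsMaximal → ∃ x ∈ M, M ≤ Ideal.span {x} ⊔ M ^ 2) :
    ∃ a : A, LinearIndependent K fun j : Fin (Module.finrank K A) => a ^ (j : ℕ) := by
  have : IsArtinianRing A := IsArtinianRing.of_finite K A
  have : IsNoetherianRing A := IsNoetherianRing.of_finite K A
  choose x hxM hx using fun M : MaximalSpectrum A => h M.asIdeal M.isMaximal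
  obtain ⟨c⟩ : Nonempty (MaximalSpectrum A ↪ K) := by
    obtain ⟨m, ⟨e⟩⟩ := Finite.exists_equiv_fin (MaximalSpectrum A)
    exact ⟨e.toEmbedding.trans (Fin.valEmbedding.trans (Infinite.natEmbedding K))⟩
  have hcop : Pairwise (Function.onFun IsCoprime fun M : MaximalSpectrum A => M.asIdeal ^ 2) := by
    intro M N hMN
    refine IsCoprime.pow ?_
    rw [Ideal.isCoprime_iff_sup_eq]
    exact M.isMaximal.coprime_of_ne N.isMaximal fun h => hMN (MaximalSpectrum.ext h)
  obtain ⟨a, ha⟩ := Ideal.exists_forall_sub_mem_ideal hcop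
    (fun M => algebraMap K A (c M) + x M)
  refine ⟨a, ?_⟩
  have haM : ∀ M : MaximalSpectrum A, a - algebraMap K A (c M) ∈ M.asIdeal := fun M => by
    have := M.asIdeal.add_mem (Ideal.pow_le_self two_ne_zero (ha M)) (hxM M)
    convert this using 1
    ring
  -- By Nakayama's lemma, `a - c M` generates `M` locally at `M`, as `x M` does modulo `M ^ 2`.
  have hquot : ∀ t : K, Module.finrank K (A ⧸ Ideal.span {a - algebraMap K A t}) ≤ 1 := by
    intro t
    by_cases htop : Ideal.span {a - algebraMap K A t} = ⊤
    · have : Subsingleton (A ⧸ Ideal.span {a - algebraMap K A t}) :=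
        Ideal.Quotient.subsingleton_iff.2 htop
      rw [Module.finrank_zero_of_subsingleton]
      exact zero_le_one
    -- only one maximal ideal contains `a - t`, since the values `c M` are distinct
    obtain ⟨M, hM, hle⟩ := Ideal.exists_le_maximal _ htop
    have hmem := hle (Ideal.mem_span_singleton_self (a - algebraMap K A t))
    have huniq : ∀ N : MaximalSpectrum A, a - algebraMap K A t ∈ N.asIdeal → c N = t := by
      intro N hN
      by_contra hne
      have h1 := N.asIdeal.sub_mem hN (haM N)
      rw [sub_sub_sub_cancel_left, ← map_sub] at h1
      exact N.isMaximal.ne_top (N.asIdeal.eq_top_of_isUnit_mem h1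
        ((IsUnit.mk0 _ (sub_ne_zero.2 hne)).map (algebraMap K A)))
    have hspan : M ≤ Ideal.span {a - algebraMap K A t} := by
      have hxt : x ⟨M, hM⟩ ∈ Ideal.span {a - algebraMap K A t} ⊔ M ^ 2 := by
        have h1 := ha ⟨M, hM⟩
        rw [huniq ⟨M, hM⟩ hmem] at h1
        have h2 := Ideal.sub_mem _
          (Ideal.mem_sup_left (T := M ^ 2) (Ideal.mem_span_singleton_self (a - algebraMap K A t)))
          (Ideal.mem_sup_right h1)
        convert h2 using 1
        ring
      have hle2 : M ≤ Ideal.span {a - algebraMap K A t} ⊔ M • M := by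
        refine (hx ⟨M, hM⟩).trans (sup_le ((Ideal.span_singleton_le_iff_mem _).2 ?_) ?_)
        · rwa [smul_eq_mul, ← pow_two]
        · rw [smul_eq_mul, ← pow_two]
          exact le_sup_right
      obtain ⟨r, hr, hrM⟩ := Submodule.exists_sub_one_mem_and_smul_le_of_fg_of_le_sup
        (IsNoetherian.noetherian M) le_rfl hle2
      have hcover : Ideal.span {a - algebraMap K A t} ⊔ Ideal.span {r} = ⊤ := by
        by_contra hne
        obtain ⟨N, hN, hleN⟩ := Ideal.exists_le_maximal _ hne
        have h1 := huniq ⟨N, hN⟩ (hleN (Ideal.mem_sup_left (Ideal.mem_span_singleton_self _)))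
        have h2 : N = M :=
          congrArg MaximalSpectrum.asIdeal (c.injective (h1.trans (huniq ⟨M, hM⟩ hmem).symm))
        have h3 : r ∈ M := h2 ▸ hleN (Ideal.mem_sup_right (Ideal.mem_span_singleton_self _))
        refine hM.ne_top ((Ideal.eq_top_iff_one M).2 ?_)
        simpa using M.sub_mem h3 hr
      intro m hm
      have h1 : (1 : A) ∈ Ideal.span {a - algebraMap K A t} ⊔ Ideal.span {r} := hcover ▸ trivial
      obtain ⟨j, hj, s, hs, hjs⟩ := Submodule.mem_sup.1 h1
      obtain ⟨s, rfl⟩ := Ideal.mem_span_singleton'.1 hs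
      have h2 : m = j * m + s * (r * m) := by linear_combination (-m) * hjs
      rw [h2]
      exact Ideal.add_mem _ (Ideal.mul_mem_right _ _ hj)
        (Ideal.mul_mem_left _ _ (hrM (Submodule.smul_mem_pointwise_smul m r M hm)))
    rw [le_antisymm hle hspan]
    obtain ⟨ε, rfl⟩ := exists_algHom_ker_eq (K := K) M
    have : Function.Injective (Ideal.kerLiftAlg ε) := Ideal.kerLiftAlg_injective ε
    simpa using LinearMap.finrank_le_finrank_of_injective
      (f := (Ideal.kerLiftAlg ε).toLinearMap) this
  have hdeg := finrank_le_natDegree_minpoly a hquot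
  exact (linearIndependent_pow a).comp (Fin.castLE hdeg) (Fin.castLE_injective hdeg)

end Commutative

/-! ### Noncommutative deformations -/

section Deformation

variable {K A : Type*} [Field K] [CommRing A] [Algebra K A]

/-- A bilinear form `φ` on `A` for which `a * b + t φ(a, b)` is a unital associative product over
`K[t]` and is not commutative: `φ` is a normalized Hochschild `2`-cocycle whose Gerstenhaber square
vanishes. -/
structure IsNoncommDeformation (φ : A →ₗ[K] A →ₗ[K] A) : Prop where
  one_left : ∀ a, φ 1 a = 0
  one_right : ∀ a, φ a 1 = 0
  cocycle : ∀ a b c, φ a b * c + φ (a * b) c = a * φ b c + φ a (b * c)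
  square : ∀ a b c, φ (φ a b) c = φ a (φ b c)
  not_symm : ∃ a b, φ a b ≠ φ b a

/-- The deformation `φ(a, b) = l(a) D(b)`, where `l` and `D` are derivations with values in the
residue field of a `K`-rational point `ε` and in the socle at `ε`. -/
theorem isNoncommDeformation_compl₁₂ (ε : A →ₐ[K] K) (l : A →ₗ[K] K) (D : A →ₗ[K] A)
    (hl : ∀ a b, l (a * b) = ε a * l b + ε b * l a)
    (hD : ∀ a b, D (a * b) = ε a • D b + ε b • D a)
    (hsoc : ∀ a b, a * D b = ε a • D b)
    (hlD : ∀ b c, l (D b) • D c = l b • D (D c))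
    (x y : A) (hlx : l x = 0) (hly : l y = 1) (hDx : D x ≠ 0) :
    IsNoncommDeformation ((LinearMap.lsmul K A).compl₁₂ l D) := by
  have hl1 : l 1 = 0 := by simpa using hl 1 1
  have hD1 : D 1 = 0 := by simpa using hD 1 1
  have hφ : ∀ a b, (LinearMap.lsmul K A).compl₁₂ l D a b = l a • D b := fun _ _ => rfl
  -- `φ(x, y)` vanishes while `φ(y, x) = D x` does not
  refine ⟨fun a => ?_, fun a => ?_, fun a b c => ?_, fun a b c => ?_, x, y, ?_⟩
  · rw [hφ, hl1, zero_smul]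
  · rw [hφ, hD1, smul_zero]
  · simp only [hφ, hl, hD, mul_smul_comm, hsoc, mul_comm _ c, smul_smul, smul_add]
    module
  · rw [hφ, hφ, hφ, hφ, map_smul, map_smul, smul_eq_mul, mul_smul, hlD]
  · rw [hφ, hφ, hlx, hly, zero_smul, one_smul]
    exact hDx.symm

/-- A linear map which kills the constants and the square of the kernel of a rational point is a
derivation at this point. -/
theorem map_mul_of_ker_sq_le (ε : A →ₐ[K] K) {B : Type*} [AddCommGroup B] [Module K B]
    (l : A →ₗ[K] B) (h1 : l 1 = 0) (h2 : ∀ a ∈ RingHom.ker ε ^ 2, l a = 0) (a b : A) :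
    l (a * b) = ε a • l b + ε b • l a := by
  have hmem : ∀ a, a - algebraMap K A (ε a) ∈ RingHom.ker ε := fun a => by simp [RingHom.mem_ker]
  have hab := h2 _ (pow_two (RingHom.ker ε) ▸ Ideal.mul_mem_mul (hmem a) (hmem b))
  have : (a - algebraMap K A (ε a)) * (b - algebraMap K A (ε b)) =
      a * b - ε a • b - ε b • a + (ε a * ε b) • 1 := by
    simp only [Algebra.smul_def, map_mul]
    ring
  rw [this, map_add, map_sub, map_sub, map_smul, map_smul, map_smul, h1, smul_zero, add_zero,
    sub_sub, sub_eq_zero] at hab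
  exact hab

/-- A linear form which kills the constants and an ideal contained in the kernel of a rational point
can be chosen nonzero at any element of this kernel outside the ideal. -/
theorem exists_linearMap_of_notMem (ε : A →ₐ[K] K) (I : Ideal A) (hI : I ≤ RingHom.ker ε) (x : A)
    (hx : x ∈ RingHom.ker ε) (hxI : x ∉ I) :
    ∃ l : A →ₗ[K] K, l 1 = 0 ∧ (∀ a ∈ I, l a = 0) ∧ l x = 1 := by
  have hx' : x ∉ Submodule.span K {(1 : A)} ⊔ I.restrictScalars K := by
    intro h
    obtain ⟨y, hy, z, hz, rfl⟩ := Submodule.mem_sup.1 h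
    obtain ⟨c, rfl⟩ := Submodule.mem_span_singleton.1 hy
    have hz' : ε z = 0 := hI hz
    have hc : ε (c • 1 + z) = 0 := hx
    rw [map_add, map_smul, map_one, hz', add_zero, smul_eq_mul, mul_one] at hc
    rw [hc, zero_smul, zero_add] at hxI
    exact hxI hz
  obtain ⟨f, hf, hfker⟩ := Submodule.exists_le_ker_of_notMem hx'
  refine ⟨(f x)⁻¹ • f, ?_, fun a ha => ?_, ?_⟩
  · have : f 1 = 0 := hfker (Submodule.mem_sup_left (Submodule.mem_span_singleton_self _))
    simp [this]
  · have : f a = 0 := hfker (Submodule.mem_sup_right ha)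
    simp [this]
  · simp [hf]

/-- A finite-dimensional commutative algebra with a rational point whose cotangent space has
dimension at least two has a noncommutative deformation. The idempotent `1 - e` cuts out the local
factor at the point. -/
theorem exists_isNoncommDeformation [FiniteDimensional K A] (ε : A →ₐ[K] K)
    (h : ¬ ∃ x ∈ RingHom.ker ε, RingHom.ker ε ≤ Ideal.span {x} ⊔ RingHom.ker ε ^ 2) :
    ∃ φ : A →ₗ[K] A →ₗ[K] A, IsNoncommDeformation φ := by
  have : IsArtinianRing A := IsArtinianRing.of_finite K A
  have : IsNoetherianRing A := IsNoetherianRing.of_finite K A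
  set M : Ideal A := RingHom.ker ε with hM
  have hmem : ∀ a, a - algebraMap K A (ε a) ∈ M := fun a => by simp [hM, RingHom.mem_ker]
  have hM2 : M ^ 2 ≤ M := Ideal.pow_le_self two_ne_zero
  push Not at h
  obtain ⟨x, hxM, hx⟩ : ∃ x ∈ M, x ∉ M ^ 2 := by
    have := h 0 M.zero_mem
    rw [Ideal.span_singleton_zero, bot_sup_eq] at this
    exact Set.not_subset.1 this
  obtain ⟨y, hyM, hy⟩ : ∃ y ∈ M, y ∉ Ideal.span {x} ⊔ M ^ 2 := Set.not_subset.1 (h x hxM)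
  obtain ⟨l, hl1, hl0, hly⟩ := exists_linearMap_of_notMem ε (Ideal.span {x} ⊔ M ^ 2)
    (sup_le ((Ideal.span_singleton_le_iff_mem _).2 hxM) hM2) y hyM hy
  have hlx : l x = 0 := hl0 x (Ideal.mem_sup_left (Ideal.mem_span_singleton_self x))
  have hl2 : ∀ a ∈ M ^ 2, l a = 0 := fun a ha => hl0 a (Ideal.mem_sup_right ha)
  have hl : ∀ a b, l (a * b) = ε a * l b + ε b * l a := map_mul_of_ker_sq_le ε l hl1 hl2
  obtain ⟨N, e, he, heN⟩ : ∃ (N : ℕ) (e : A), IsIdempotentElem e ∧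
      M ^ (N + 3) = Ideal.span {e} := by
    obtain ⟨N, hN⟩ := IsArtinian.monotone_stabilizes (R := A) (M := A)
      ⟨fun m => OrderDual.toDual (M ^ m), fun _ _ h => Ideal.pow_le_pow_right h⟩
    have hN' : ∀ m, N ≤ m → M ^ N = M ^ m := hN
    refine ⟨N, (Ideal.isIdempotentElem_iff_of_fg _ (IsNoetherian.noetherian _)).1 ?_⟩
    change M ^ (N + 3) * M ^ (N + 3) = M ^ (N + 3)
    rw [← pow_add, ← hN' (N + 3 + (N + 3)) (by omega), hN' (N + 3) (by omega)]
  have heM : e ∈ M ^ (N + 3) := heN ▸ Ideal.mem_span_singleton_self e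
  have heM2 : e ∈ M ^ 2 := Ideal.pow_le_pow_right (by omega) heM
  have he0 : ε e = 0 := hM2 heM2
  -- If the local factor has square zero maximal ideal, then `D` is the projection to this ideal;
  -- otherwise `D` is a tangent vector times an element of the socle which is killed by `l`.
  by_cases hcase : ∀ z ∈ M ^ 2, (1 - e) * z = 0
  · let D : A →ₗ[K] A :=
      LinearMap.mul K A (1 - e) ∘ₗ (LinearMap.id - (Algebra.linearMap K A) ∘ₗ ε.toLinearMap)
    have hDapp : ∀ a, D a = (1 - e) * (a - algebraMap K A (ε a)) := fun _ => rfl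
    have hεD : ∀ a, ε (D a) = 0 := fun a => by simp [hDapp]
    refine ⟨_, isNoncommDeformation_compl₁₂ ε l D hl ?_ ?_ ?_ x y hlx hly ?_⟩
    · refine map_mul_of_ker_sq_le ε D (by simp [hDapp]) fun a ha => ?_
      have : ε a = 0 := hM2 ha
      rw [hDapp, this, map_zero, sub_zero, hcase a ha]
    · intro a b
      have := hcase _ (pow_two M ▸ Ideal.mul_mem_mul (hmem a) (hmem b))
      rw [Algebra.smul_def, hDapp]
      linear_combination this
    · intro b c
      have h1 : l (D b) = l b := by
        have : D b = b - ε b • 1 - e * (b - algebraMap K A (ε b)) := by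
          rw [hDapp, Algebra.smul_def]
          ring
        rw [this, map_sub, map_sub, map_smul, hl1, hl2 _ (Ideal.mul_mem_right _ _ heM2)]
        simp
      have h2 : D (D c) = D c := by
        rw [hDapp (D c), hεD, map_zero, sub_zero, hDapp]
        linear_combination (c - algebraMap K A (ε c)) * he.eq
      rw [h1, h2]
    · intro hDx
      have hεx : ε x = 0 := hxM
      rw [hDapp, hεx, map_zero, sub_zero, sub_mul, one_mul, sub_eq_zero] at hDx
      exact hx (hDx ▸ Ideal.mul_mem_right _ _ heM2)
  · push Not at hcase
    obtain ⟨z, hz, hez⟩ := hcase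
    -- a nonzero element of the socle at `ε`, inside the square of the maximal ideal
    obtain ⟨s, hs2, hs0, hsM⟩ : ∃ s ∈ M ^ 2, s ≠ 0 ∧ ∀ a ∈ M, a * s = 0 := by
      have hex : ∃ m, M ^ m * Ideal.span {(1 - e) * z} = ⊥ := by
        refine ⟨N + 3, ?_⟩
        rw [heN, Ideal.span_singleton_mul_span_singleton, Ideal.span_singleton_eq_bot]
        linear_combination (-z) * he.eq
      classical
      have hmin := Nat.find_spec hex
      obtain ⟨m, hm⟩ : ∃ m, Nat.find hex = m + 1 := by
        refine Nat.exists_eq_succ_of_ne_zero fun h0 => hez ?_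
        rw [h0, pow_zero, one_mul, Ideal.span_singleton_eq_bot] at hmin
        exact hmin
      have hne : M ^ m * Ideal.span {(1 - e) * z} ≠ ⊥ := Nat.find_min hex (by omega)
      obtain ⟨s, hs, hs0⟩ := Submodule.exists_mem_ne_zero_of_ne_bot hne
      refine ⟨s, ?_, hs0, fun a ha => ?_⟩
      · have hle : Ideal.span {(1 - e) * z} ≤ M ^ 2 :=
          (Ideal.span_singleton_le_iff_mem _).2 (Ideal.mul_mem_left _ _ hz)
        exact hle (Ideal.mul_le_right hs)
      · have := Ideal.mul_mem_mul ha hs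
        rwa [← mul_assoc, ← pow_succ', ← hm, hmin] at this
    obtain ⟨l', hl'1, hl'2, hl'x⟩ := exists_linearMap_of_notMem ε (M ^ 2) hM2 x hxM hx
    have hl' : ∀ a b, l' (a * b) = ε a * l' b + ε b * l' a := map_mul_of_ker_sq_le ε l' hl'1 hl'2
    let D : A →ₗ[K] A := l'.smulRight s
    have hDapp : ∀ a, D a = l' a • s := fun _ => rfl
    have hsoc : ∀ a, a * s = ε a • s := fun a => by
      have := hsM _ (hmem a)
      rw [Algebra.smul_def]
      linear_combination this
    refine ⟨_, isNoncommDeformation_compl₁₂ ε l D hl ?_ ?_ ?_ x y hlx hly ?_⟩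
    · intro a b
      rw [hDapp, hDapp, hDapp, hl']
      module
    · intro a b
      rw [hDapp, mul_smul_comm, hsoc, smul_comm]
    · intro b c
      rw [hDapp b, hDapp c, map_smul, map_smul, hDapp s, hl2 s hs2, hl'2 s hs2]
      simp
    · rw [hDapp, hl'x, one_smul]
      exact hs0

/-- A finite-dimensional commutative algebra over an algebraically closed field which is not
generated by one element has a noncommutative deformation. -/
theorem exists_isNoncommDeformation_of_forall_not_linearIndependent [IsAlgClosed K]
    [FiniteDimensional K A]
    (h : ∀ a : A, ¬ LinearIndependent K fun j : Fin (Module.finrank K A) => a ^ (j : ℕ)) :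
    ∃ φ : A →ₗ[K] A →ₗ[K] A, IsNoncommDeformation φ := by
  obtain ⟨M, hMmax, hM⟩ : ∃ M : Ideal A, M.IsMaximal ∧
      ¬ ∃ x ∈ M, M ≤ Ideal.span {x} ⊔ M ^ 2 := by
    by_contra! hcon
    obtain ⟨a, ha⟩ := exists_linearIndependent_pow (K := K) hcon
    exact h a ha
  obtain ⟨ε, rfl⟩ := exists_algHom_ker_eq (K := K) M
  exact exists_isNoncommDeformation ε hM

end Deformation

/-! ### Noncommutative deformations of based algebras -/

namespace AlgStr

variable {n : ℕ} {R : Type u} [CommRing R]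

theorem linearMap_apply_eq_sum (s : AlgStr n R) (f : s.Carrier →ₗ[R] s.Carrier) (x : s.Carrier)
    (r : Fin n) : f x r = ∑ m, x m * f (s.stdBasis m) r := by
  conv_lhs => rw [← s.stdBasis.sum_repr x, map_sum, carrier_sum_apply]
  exact Finset.sum_congr rfl fun m _ => by
    rw [map_smul, carrier_smul_apply, stdBasis_repr]

open Polynomial in
/-- A based commutative algebra over an algebraically closed field on which the polynomial law
`a ↦ 1 ∧ a ∧ ⋯ ∧ a ^ (n - 1)` vanishes is the fibre at `0` of a family over the affine line, with
constant unit, whose generic fibre is not commutative. -/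
theorem exists_noncomm_deformation {K : Type u} [Field K] [IsAlgClosed K] (s : AlgStr n K)
    (hcomm : ∀ i j, s.c i j = s.c j i) (hs : s.genDet = 0) :
    ∃ t : AlgStr n K[X], t.map (evalRingHom 0) = s ∧ t.one = (fun r => C (s.one r)) ∧
      ∃ i j r, t.c i j r ≠ t.c j i r := by
  let _ : CommRing s.Carrier :=
    { (inferInstance : Ring s.Carrier) with
      mul_comm := fun a b => by
        funext r
        rw [carrier_mul_apply, carrier_mul_apply, Finset.sum_comm]
        refine Finset.sum_congr rfl fun i _ => Finset.sum_congr rfl fun j _ => ?_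
        rw [hcomm j i, mul_comm (a j)] }
  have hfin : FiniteDimensional K s.Carrier := Module.Finite.of_basis s.stdBasis
  have hrank : Module.finrank K s.Carrier = n := by
    rw [Module.finrank_eq_card_basis s.stdBasis, Fintype.card_fin]
  obtain ⟨φ, hφ⟩ := exists_isNoncommDeformation_of_forall_not_linearIndependent
    (K := K) (A := s.Carrier) fun a ha => by
      rw [hrank] at ha
      have h0 := s.genDet_eq_zero_iff.1 hs K (RingHom.id K) a
      have hu : IsUnit (s.powMatrix a) := Matrix.linearIndependent_cols_iff_isUnit.1 ha
      exact ((Matrix.isUnit_iff_isUnit_det _).1 hu).ne_zero h0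
  have hmulr : ∀ (x : s.Carrier) (l r : Fin n),
      (x * s.stdBasis l : s.Carrier) r = ∑ m, x m * s.c m l r := fun x l r => by
    rw [← LinearMap.mul_apply' (R := K), ← LinearMap.flip_apply, linearMap_apply_eq_sum]
    refine Finset.sum_congr rfl fun m _ => ?_
    rw [LinearMap.flip_apply, LinearMap.mul_apply', stdBasis_mul_apply]
  have hmull : ∀ (x : s.Carrier) (l r : Fin n),
      (s.stdBasis l * x : s.Carrier) r = ∑ m, x m * s.c l m r := fun x l r => by
    rw [← LinearMap.mul_apply' (R := K), linearMap_apply_eq_sum]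
    refine Finset.sum_congr rfl fun m _ => ?_
    rw [LinearMap.mul_apply', stdBasis_mul_apply]
  let d : Fin n → Fin n → Fin n → K := fun i j r => φ (s.stdBasis i) (s.stdBasis j) r
  have hdl : ∀ (x : s.Carrier) (l r : Fin n), φ x (s.stdBasis l) r = ∑ m, x m * d m l r :=
    fun x l r => by rw [← LinearMap.flip_apply, linearMap_apply_eq_sum]; rfl
  have hdr : ∀ (x : s.Carrier) (l r : Fin n), φ (s.stdBasis l) x r = ∑ m, x m * d l m r :=
    fun x l r => by rw [linearMap_apply_eq_sum]
  have hcc : ∀ i j l r, ∑ m, (s.c i j m * d m l r + d i j m * s.c m l r) =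
      ∑ m, (s.c j l m * d i m r + d j l m * s.c i m r) := by
    intro i j l r
    have h := congrFun (hφ.cocycle (s.stdBasis i) (s.stdBasis j) (s.stdBasis l)) r
    rw [carrier_add_apply, carrier_add_apply, hmulr, hdl, hmull, hdr] at h
    simp only [stdBasis_mul_apply] at h
    rw [Finset.sum_add_distrib, Finset.sum_add_distrib, add_comm, add_comm (∑ m, s.c j l m * _)]
    exact h
  have hdd : ∀ i j l r, ∑ m, d i j m * d m l r = ∑ m, d j l m * d i m r := by
    intro i j l r
    have h := congrFun (hφ.square (s.stdBasis i) (s.stdBasis j) (s.stdBasis l)) r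
    rwa [hdl, hdr] at h
  have hexp : ∀ p q p' q' : Fin n → K,
      ∑ m, (C (p m) + X * C (q m)) * (C (p' m) + X * C (q' m)) =
        C (∑ m, p m * p' m) + X * C (∑ m, (p m * q' m + q m * p' m)) +
          X ^ 2 * C (∑ m, q m * q' m) := by
    intro p q p' q'
    simp only [map_sum, Finset.mul_sum, ← Finset.sum_add_distrib]
    refine Finset.sum_congr rfl fun m _ => ?_
    simp only [map_add, map_mul]
    ring
  let t : AlgStr n K[X] :=
    { c := fun i j r => C (s.c i j r) + X * C (d i j r)
      one := fun r => C (s.one r)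
      assoc := fun i j l r => by rw [hexp, hexp, s.assoc, hcc, hdd]
      unit_mul := fun j r => by
        have h := hexp s.one (fun _ => 0) (fun m => s.c m j r) (fun m => d m j r)
        have h1 := congrFun (hφ.one_left (s.stdBasis j)) r
        rw [hdl] at h1
        simp only [map_zero, mul_zero, add_zero, zero_mul, Finset.sum_const_zero] at h
        rw [h, s.unit_mul]
        change C _ + X * C (∑ m, (1 : s.Carrier) m * d m j r) = _
        rw [h1, carrier_zero_apply]
        simp [apply_ite C]
      mul_unit := fun j r => by
        have h := hexp s.one (fun _ => 0) (fun m => s.c j m r) (fun m => d j m r)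
        have h1 := congrFun (hφ.one_right (s.stdBasis j)) r
        rw [hdr] at h1
        simp only [map_zero, mul_zero, add_zero, zero_mul, Finset.sum_const_zero] at h
        rw [h, s.mul_unit]
        change C _ + X * C (∑ m, (1 : s.Carrier) m * d j m r) = _
        rw [h1, carrier_zero_apply]
        simp [apply_ite C] }
  refine ⟨t, ?_, rfl, ?_⟩
  · refine eq_of_c_eq_of_one_eq ?_ ?_
    · funext i j r
      change evalRingHom 0 (C (s.c i j r) + X * C (d i j r)) = _
      simp
    · funext r
      change evalRingHom 0 (C (s.one r)) = _
      simp
  · by_contra! hcon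
    have hd : ∀ i j, φ (s.stdBasis i) (s.stdBasis j) = φ (s.stdBasis j) (s.stdBasis i) := by
      intro i j
      funext r
      have h : C (s.c i j r) + X * C (d i j r) = C (s.c j i r) + X * C (d j i r) := hcon i j r
      simpa [hcomm i j] using h
    obtain ⟨a, b, hab⟩ := hφ.not_symm
    have hflip : φ = φ.flip := s.stdBasis.ext fun i => s.stdBasis.ext fun j => hd i j
    exact hab (congrArg (fun f => f a b) hflip)

end AlgStr

/-! ### Dimension of localized polynomial rings and of their subalgebras -/

section Dimension

open MvPolynomial

theorem awayMap_surjective {A B : Type*} [CommRing A] [CommRing B] (g : A →+* B)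
    (hg : Function.Surjective g) (f : A) :
    Function.Surjective (Localization.awayMap g f) := by
  rw [Localization.awayMap_surjective_iff]
  intro b
  obtain ⟨a, rfl⟩ := hg b
  exact ⟨a, 0, by simp⟩

theorem ringKrullDim_away_succ_le {A B : Type*} [CommRing A] [IsDomain A] [CommRing B] (g : A →+* B)
    (hg : Function.Surjective g) (f : A) (hf : f ≠ 0) (r : A) (hr : r ≠ 0) (hgr : g r = 0) :
    ringKrullDim (Localization.Away (g f)) + 1 ≤ ringKrullDim (Localization.Away f) := by
  have hpow := powers_le_nonZeroDivisors_of_noZeroDivisors hf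
  have : IsDomain (Localization.Away f) := IsLocalization.isDomain_localization hpow
  refine ringKrullDim_succ_le_of_surjective _ (awayMap_surjective g hg f)
    (r := algebraMap A (Localization.Away f) r) ?_ ?_
  · rw [mem_nonZeroDivisors_iff_ne_zero]
    exact (map_ne_zero_iff _ (IsLocalization.injective _ hpow)).2 hr
  · rw [Localization.awayMap, IsLocalization.Away.map, IsLocalization.map_eq, hgr, map_zero]

/-- The locus where a polynomial does not vanish has full dimension, if it has a rational point. -/
theorem card_le_ringKrullDim_localizationAway {k : Type*} [Field k] (σ : Type*) [Finite σ]
    (f : MvPolynomial σ k) (x : σ → k) (hx : eval x f ≠ 0) :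
    (Nat.card σ : WithBot ℕ∞) ≤ ringKrullDim (Localization.Away f) := by
  have key : ∀ (N : ℕ) (f : MvPolynomial (Fin N) k) (x : Fin N → k), eval x f ≠ 0 →
      (N : WithBot ℕ∞) ≤ ringKrullDim (Localization.Away f) := by
    intro N
    induction N with
    | zero =>
      intro f x hx
      have hf : f ≠ 0 := fun h => hx (by rw [h, map_zero])
      have : IsDomain (Localization.Away f) :=
        IsLocalization.isDomain_localization (powers_le_nonZeroDivisors_of_noZeroDivisors hf)
      simpa using ringKrullDim_nonneg_of_nontrivial
    | succ N IH =>
      intro f x hx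
      have hf : f ≠ 0 := fun h => hx (by rw [h, map_zero])
      -- restriction to the hyperplane through the point on which the first coordinate is constant
      let ψ : MvPolynomial (Fin (N + 1)) k →ₐ[k] MvPolynomial (Fin N) k :=
        aeval (Fin.cons (C (x 0)) X)
      have hψ : Function.Surjective ψ := by
        intro p
        refine ⟨rename Fin.succ p, ?_⟩
        have : ψ.comp (rename Fin.succ) = AlgHom.id k _ := by
          ext i
          simp [ψ]
        exact congrArg (fun h : MvPolynomial (Fin N) k →ₐ[k] MvPolynomial (Fin N) k => h p) this
      have heval : ((aeval (Fin.tail x)).comp ψ : MvPolynomial (Fin (N + 1)) k →ₐ[k] k) =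
          aeval x := by
        ext i
        refine Fin.cases ?_ (fun i => ?_) i <;> simp [ψ, Fin.tail]
      have h1 := IH (ψ f) (Fin.tail x) (by
        rw [← coe_aeval_eq_eval] at hx ⊢
        rw [← heval] at hx
        exact hx)
      have h2 := ringKrullDim_away_succ_le ψ.toRingHom hψ f hf (X 0 - C (x 0))
        (fun h => by
          have := congrArg (eval fun _ => x 0 + 1) h
          simp at this)
        (show ψ (X 0 - C (x 0)) = 0 by simp [ψ])
      refine le_trans ?_ h2
      push_cast
      gcongr
      exact h1
  obtain ⟨N, ⟨e⟩⟩ := Finite.exists_equiv_fin σ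
  let ψ : MvPolynomial σ k →ₐ[k] MvPolynomial (Fin N) k := rename e
  have hψ : Function.Surjective ψ := (renameEquiv k e).surjective
  have h1 := key N (ψ f) (x ∘ e.symm) (by
    rw [eval_rename, Function.comp_assoc, e.symm_comp_self]
    exact hx)
  rw [Nat.card_congr e, Nat.card_fin]
  exact h1.trans (ringKrullDim_le_of_surjective _ (awayMap_surjective ψ.toRingHom hψ f))

theorem ringKrullDim_le_of_isIntegral {A B : Type*} [CommRing A] [CommRing B] [Algebra A B]
    [Algebra.IsIntegral A B] : ringKrullDim B ≤ ringKrullDim A := by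
  refine Order.krullDim_le_of_strictMono (PrimeSpectrum.comap (algebraMap A B)) fun p q hpq => ?_
  exact Ideal.IsIntegral.comap_lt_comap hpq

/-- A finitely generated subalgebra of a localized polynomial ring in finitely many variables has
dimension at most the number of variables. -/
theorem ringKrullDim_le_card_of_injective {k : Type u} [Field k] {σ : Type} [Finite σ]
    (f : MvPolynomial σ k) (hf : f ≠ 0) {B : Type u} [CommRing B] [Algebra k B]
    [Algebra.FiniteType k B] (φ : B →ₐ[k] Localization.Away f) (hφ : Function.Injective φ) :
    ringKrullDim B ≤ Nat.card σ := by
  have hpow := powers_le_nonZeroDivisors_of_noZeroDivisors hf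
  have : IsDomain (Localization.Away f) := IsLocalization.isDomain_localization hpow
  have : Nontrivial B := φ.toRingHom.domain_nontrivial
  obtain ⟨m, g, hg, hint⟩ := exists_integral_inj_algHom_of_fg k B
  let _ := g.toRingHom.toAlgebra
  have : Algebra.IsIntegral (MvPolynomial (Fin m) k) B := ⟨hint⟩
  refine (ringKrullDim_le_of_isIntegral (A := MvPolynomial (Fin m) k)).trans ?_
  rw [MvPolynomial.ringKrullDim_of_isNoetherianRing, ringKrullDim_eq_zero_of_field, zero_add,
    Nat.card_fin]
  have : FaithfulSMul (MvPolynomial σ k) (Localization.Away f) :=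
    (faithfulSMul_iff_algebraMap_injective _ _).2 (IsLocalization.injective _ hpow)
  have halg : Algebra.IsAlgebraic (MvPolynomial σ k) (Localization.Away f) :=
    IsLocalization.isAlgebraic _ (Submonoid.powers f)
  have h1 := trdeg_add_eq k (MvPolynomial σ k) (A := Localization.Away f)
  have h2 := trdeg_le_of_injective (φ.comp g) (hφ.comp hg)
  rw [← h1, trdeg_eq_zero (R := MvPolynomial σ k), MvPolynomial.trdeg_of_isDomain,
    MvPolynomial.trdeg_of_isDomain, add_zero, Cardinal.lift_le, Cardinal.mk_fin,
    ← Nat.cast_card, Nat.cast_le] at h2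
  exact_mod_cast h2

end Dimension

/-! ### Universal families and their parametrization by cyclic algebras -/

section Universal

variable {k : Type u} [Field k] {n : ℕ}

/-- `U` is universal among `n`-dimensional based algebras over commutative `k`-algebras, with the
additional requirement `e_1 = 1` if the proposition `P` holds. Uniqueness of the classifying
homomorphisms is expressed by the generation of `Q` by the structure constants and the coordinates
of the unit. -/
structure IsUniversal (k : Type u) [Field k] [NeZero n] {Q : Type u} [CommRing Q] [Algebra k Q]
    (U : AlgStr n Q) (P : Prop) : Prop where
  one_eq : P → U.one = fun r => if r = 0 then 1 else 0
  lift : ∀ (T : Type u) [CommRing T] [Algebra k T] (s : AlgStr n T),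
    (P → s.one = fun r => if r = 0 then 1 else 0) → ∃ φ : Q →ₐ[k] T, U.map (φ : Q →+* T) = s
  adjoin_eq_top : Algebra.adjoin k
    (Set.range (fun x : Fin n × Fin n × Fin n => U.c x.1 x.2.1 x.2.2) ∪ Set.range U.one) = ⊤

variable {Q : Type u} [CommRing Q] [Algebra k Q] {U : AlgStr n Q} {P : Prop}

theorem IsUniversal.algHom_ext [NeZero n] (hU : IsUniversal k U P) {T : Type u} [CommRing T]
    [Algebra k T] {φ ψ : Q →ₐ[k] T} (h : U.map (φ : Q →+* T) = U.map (ψ : Q →+* T)) : φ = ψ := by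
  refine AlgHom.ext_of_adjoin_eq_top hU.adjoin_eq_top ?_
  rintro _ (⟨⟨i, j, r⟩, rfl⟩ | ⟨r, rfl⟩)
  · exact congrFun (congrFun (congrFun (congrArg AlgStr.c h) i) j) r
  · exact congrFun (congrArg AlgStr.one h) r

theorem IsUniversal.finiteType [NeZero n] (hU : IsUniversal k U P) : Algebra.FiniteType k Q :=
  ⟨Subalgebra.fg_def.2 ⟨_, (Set.finite_range _).union (Set.finite_range _), hU.adjoin_eq_top⟩⟩

/-- Variables for the entries of an `n × n` matrix outside the columns in `C` and, if `J` holds, for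
a vector of length `n`. -/
abbrev ParamVar (n : ℕ) (C : Fin n → Prop) (J : Prop) : Type :=
  ({j : Fin n // ¬ C j} × Fin n) ⊕ {_j : Fin n // J}

variable (k) (C : Fin n → Prop) (J : Prop)

open Classical in
/-- The generic matrix whose columns in `C` are those of the identity matrix. -/
noncomputable def paramMatrix : Matrix (Fin n) (Fin n) (MvPolynomial (ParamVar n C J) k) :=
  Matrix.of fun i j => if h : C j then (if i = j then 1 else 0) else
    MvPolynomial.X (.inl (⟨j, h⟩, i))

open Classical in
/-- The generic vector if `J` holds, and the zero vector otherwise. -/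
noncomputable def paramVec : Fin n → MvPolynomial (ParamVar n C J) k :=
  fun j => if h : J then MvPolynomial.X (.inr ⟨j, h⟩) else 0

/-- The coordinate ring of the parameter space: the determinant of the generic matrix is
inverted. -/
abbrev ParamRing : Type u := Localization.Away (paramMatrix k C J).det

variable {k C J}

theorem paramMatrix_apply_of {j : Fin n} (h : C j) (i : Fin n) :
    paramMatrix k C J i j = if i = j then 1 else 0 := by
  rw [paramMatrix, Matrix.of_apply, dif_pos h]

theorem paramMatrix_apply_of_not {j : Fin n} (h : ¬ C j) (i : Fin n) :
    paramMatrix k C J i j = MvPolynomial.X (.inl (⟨j, h⟩, i)) := by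
  rw [paramMatrix, Matrix.of_apply, dif_neg h]

theorem exists_paramHom {T : Type*} [CommRing T] [Algebra k T] (H : Matrix (Fin n) (Fin n) T)
    (f : Fin n → T) (hC : ∀ i j, C j → H i j = if i = j then 1 else 0) (hJ : ¬ J → f = 0) :
    ∃ θ : MvPolynomial (ParamVar n C J) k →ₐ[k] T,
      (paramMatrix k C J).map θ = H ∧ (fun j => θ (paramVec k C J j)) = f := by
  refine ⟨MvPolynomial.aeval (Sum.elim (fun x => H x.2 x.1) fun x => f x.1), ?_, ?_⟩
  · ext i j
    by_cases h : C j
    · rw [hC i j h, Matrix.map_apply, paramMatrix_apply_of h]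
      split_ifs <;> simp
    · simp [paramMatrix_apply_of_not h]
  · funext j
    by_cases h : J
    · simp [paramVec, h]
    · simp [paramVec, h, hJ h]

variable (k C J) in
/-- The identity matrix is a rational point of the parameter space. -/
theorem exists_eval_det_paramMatrix_ne_zero :
    ∃ x, MvPolynomial.eval x (paramMatrix k C J).det ≠ 0 := by
  obtain ⟨θ, hθ, -⟩ := exists_paramHom (k := k) (C := C) (J := J) (1 : Matrix (Fin n) (Fin n) k) 0
    (fun i j _ => Matrix.one_apply) (fun _ => rfl)
  refine ⟨fun v => θ (MvPolynomial.X v), ?_⟩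
  have : MvPolynomial.eval (fun v => θ (MvPolynomial.X v)) (paramMatrix k C J).det =
      θ (paramMatrix k C J).det := by
    rw [← MvPolynomial.coe_aeval_eq_eval]
    exact congrArg (fun g : MvPolynomial (ParamVar n C J) k →ₐ[k] k => g (paramMatrix k C J).det)
      (MvPolynomial.aeval_unique θ).symm
  rw [this, AlgHom.map_det]
  change ((paramMatrix k C J).map θ).det ≠ 0
  rw [hθ, Matrix.det_one]
  exact one_ne_zero

variable (k C J) in
theorem det_paramMatrix_ne_zero : (paramMatrix k C J).det ≠ 0 := by
  obtain ⟨x, hx⟩ := exists_eval_det_paramMatrix_ne_zero k C J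
  exact fun h => hx (by rw [h, map_zero])

instance : IsDomain (ParamRing k C J) :=
  IsLocalization.isDomain_localization
    (powers_le_nonZeroDivisors_of_noZeroDivisors (det_paramMatrix_ne_zero k C J))

/-- The homomorphism `π` classifies the algebra with a generator `a` whose power matrix is the
generic matrix and for which the generic vector holds the coefficients of the relation satisfied by
`a ^ n`. -/
structure IsParam (U : AlgStr n Q) (C : Fin n → Prop) (J : Prop)
    (π : Q →ₐ[k] ParamRing k C J) (a : Fin n → ParamRing k C J) : Prop where
  powMatrix_eq : (U.map (π : Q →+* _)).powMatrix a =
    (paramMatrix k C J).map (algebraMap _ (ParamRing k C J))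
  powCoord_eq : (U.map (π : Q →+* _)).powCoord a n =
    ((paramMatrix k C J).map (algebraMap _ (ParamRing k C J))).mulVec
      fun j => algebraMap _ (ParamRing k C J) (paramVec k C J j)
  comm : ∀ i j r, π (U.c i j r) = π (U.c j i r)

theorem det_map_paramMatrix : ((paramMatrix k C J).map (algebraMap _ (ParamRing k C J))).det =
    algebraMap _ (ParamRing k C J) (paramMatrix k C J).det :=
  ((algebraMap _ (ParamRing k C J)).map_det _).symm

theorem isUnit_det_map_paramMatrix :
    IsUnit ((paramMatrix k C J).map (algebraMap _ (ParamRing k C J))).det := by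
  rw [det_map_paramMatrix]
  exact IsLocalization.Away.algebraMap_isUnit _

theorem IsUniversal.exists_isParam [NeZero n] (hU : IsUniversal k U P) (hPC : P → C 0) :
    ∃ (π : Q →ₐ[k] ParamRing k C J) (a : Fin n → ParamRing k C J), IsParam U C J π a := by
  obtain ⟨s, a, hs, ha, hcomm⟩ := AlgStr.exists_powMatrix_eq
    ((paramMatrix k C J).map (algebraMap _ (ParamRing k C J))) isUnit_det_map_paramMatrix
    fun j => algebraMap _ (ParamRing k C J) (paramVec k C J j)
  obtain ⟨π, hπ⟩ := hU.lift _ s fun hP => by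
    funext r
    have h1 := congrFun (congrFun hs r) 0
    rw [AlgStr.powMatrix_apply, Fin.val_zero, AlgStr.powCoord_zero] at h1
    rw [h1, Matrix.map_apply, paramMatrix_apply_of (hPC hP)]
    split_ifs <;> simp
  refine ⟨π, a, ⟨hπ ▸ hs, hπ ▸ ha, fun i j r => ?_⟩⟩
  have : (U.map (π : Q →+* ParamRing k C J)).c i j r =
      (U.map (π : Q →+* ParamRing k C J)).c j i r := by
    rw [hπ, hcomm]
  exact this

/-- A point of the universal family over a field, with a generator whose power matrix and relation
satisfy the constraints given by `C` and `J`, specializes the parametrized family. -/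
theorem IsParam.ker_le [NeZero n] (hU : IsUniversal k U P) {π : Q →ₐ[k] ParamRing k C J}
    {a : Fin n → ParamRing k C J} (hπ : IsParam U C J π a) {L : Type u} [CommRing L]
    (φ : Q →+* L) (b : Fin n → L) (hdet : IsUnit ((U.map φ).powMatrix b).det)
    (hC : ∀ i j, C j → (U.map φ).powMatrix b i j = if i = j then 1 else 0)
    (hJ : ¬ J → (U.map φ).powCoord b n = 0) : RingHom.ker π ≤ RingHom.ker φ := by
  let _ : Algebra k L := (φ.comp (algebraMap k Q)).toAlgebra
  let φ' : Q →ₐ[k] L := { φ with commutes' := fun _ => rfl }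
  have hinv := Matrix.mul_nonsing_inv _ hdet
  obtain ⟨θ, hθ1, hθ2⟩ := exists_paramHom (k := k) (C := C) (J := J) ((U.map φ).powMatrix b)
    (((U.map φ).powMatrix b)⁻¹.mulVec ((U.map φ).powCoord b n)) hC
    (fun h => by rw [hJ h, Matrix.mulVec_zero])
  have hθdet : IsUnit (θ (paramMatrix k C J).det) := by
    rw [AlgHom.map_det]
    change IsUnit ((paramMatrix k C J).map θ).det
    rwa [hθ1]
  let ψ : ParamRing k C J →+* L := 
    IsLocalization.Away.lift (paramMatrix k C J).det (g := θ.toRingHom) hθdet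
  have hψ : ∀ y, ψ (algebraMap _ _ y) = θ y :=
    IsLocalization.Away.lift_eq (g := θ.toRingHom) _ hθdet
  let ψ' : ParamRing k C J →ₐ[k] L :=
    { ψ with
      commutes' := fun c => by
        change ψ (algebraMap k (ParamRing k C J) c) = _
        rw [IsScalarTower.algebraMap_apply k (MvPolynomial (ParamVar n C J) k), hψ, θ.commutes] }
  have hmat : ((paramMatrix k C J).map (algebraMap _ (ParamRing k C J))).map ψ =
      (U.map φ).powMatrix b := by
    rw [← hθ1]
    ext i j
    exact hψ _
  have h1 : ((U.map (π : Q →+* _)).map ψ).powMatrix (fun i => ψ (a i)) =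
      (U.map φ).powMatrix b := by
    rw [AlgStr.powMatrix_map, hπ.powMatrix_eq, hmat]
  have h2 : ((U.map (π : Q →+* _)).map ψ).powCoord (fun i => ψ (a i)) n =
      (U.map φ).powCoord b n := by
    rw [AlgStr.powCoord_map, hπ.powCoord_eq]
    have h3 : (U.map φ).powCoord b n = ((U.map φ).powMatrix b).mulVec fun j =>
        θ (paramVec k C J j) := by
      rw [hθ2, Matrix.mulVec_mulVec, hinv, Matrix.one_mulVec]
    rw [h3, ← hmat]
    funext i
    rw [RingHom.map_mulVec]
    congr 1
    funext j
    exact hψ _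
  have h4 : φ' = ψ'.comp π := hU.algHom_ext
    (AlgStr.eq_of_powMatrix_eq h1 (h1 ▸ hdet) h2).symm
  intro x hx
  rw [RingHom.mem_ker] at hx ⊢
  have h5 : φ x = ψ' (π x) := congrArg (fun f : Q →ₐ[k] L => f x) h4
  rw [h5]
  exact (congrArg ψ' hx).trans (map_zero ψ')

end Universal

/-! ### The locus of algebras of maximal degree of algebraicity -/

section Locus

variable {k : Type u} [Field k] {n : ℕ} {Q : Type u} [CommRing Q] [Algebra k Q]
  {U : AlgStr n Q} {P : Prop} {C : Fin n → Prop} {J : Prop}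

/-- The kernel of a homomorphism to the coordinate ring of a parameter space, as a point of the
base. -/
noncomputable def paramPoint (π : Q →ₐ[k] ParamRing k C J) : PrimeSpectrum Q :=
  ⟨RingHom.ker π, RingHom.ker_isPrime _⟩

theorem IsParam.isUnit_det {π : Q →ₐ[k] ParamRing k C J} {a : Fin n → ParamRing k C J}
    (hπ : IsParam U C J π a) : IsUnit ((U.map (π : Q →+* _)).powMatrix a).det := by
  rw [hπ.powMatrix_eq]
  exact isUnit_det_map_paramMatrix

variable [NeZero n]

theorem IsParam.paramPoint_mem {π : Q →ₐ[k] ParamRing k C J} {a : Fin n → ParamRing k C J}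
    (hπ : IsParam U C J π a) : paramPoint π ∈ U.degEq n :=
  U.mem_degEq_rank_of_det_ne_zero (π : Q →+* ParamRing k C J) (paramPoint π) rfl a
    hπ.isUnit_det.ne_zero

theorem AlgStr.powMatrix_zero_apply (s : AlgStr n Q) (a : Fin n → Q) (i : Fin n) :
    s.powMatrix a i 0 = s.one i := by
  rw [powMatrix_apply, Fin.val_zero, powCoord_zero]

theorem IsUniversal.map_one_apply (hU : IsUniversal k U P) (hP : P) {L : Type u} [CommRing L]
    (φ : Q →+* L) (i : Fin n) : (U.map φ).one i = if i = 0 then 1 else 0 := by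
  change φ (U.one i) = _
  rw [hU.one_eq hP]
  by_cases h : i = 0 <;> simp [h]

/-- Over a purely transcendental extension of the residue field, the generic element of an algebra
of maximal degree of algebraicity is a generator. -/
theorem IsParam.paramPoint_le (hU : IsUniversal k U P)
    {π : Q →ₐ[k] ParamRing k (fun j : Fin n => P ∧ j = 0) True}
    {a : Fin n → ParamRing k (fun j : Fin n => P ∧ j = 0) True} (hπ : IsParam U _ True π a)
    {p : PrimeSpectrum Q} (hp : p ∈ U.degEq n) : paramPoint π ≤ p := by
  let κ := p.asIdeal.ResidueField
  let F := FractionRing (MvPolynomial (Fin n) κ)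
  let φ : Q →+* F :=
    (algebraMap (MvPolynomial (Fin n) κ) F).comp (MvPolynomial.C.comp (algebraMap Q κ))
  have hinj : Function.Injective (algebraMap (MvPolynomial (Fin n) κ) F) :=
    IsFractionRing.injective _ _
  have hker : RingHom.ker φ = p.asIdeal := by
    ext x
    rw [RingHom.mem_ker]
    change algebraMap (MvPolynomial (Fin n) κ) F (MvPolynomial.C (algebraMap Q κ x)) = 0 ↔ _
    rw [map_eq_zero_iff _ hinj, MvPolynomial.C_eq_zero, Ideal.algebraMap_residueField_eq_zero]
  have hdet : ((U.map φ).powMatrix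
      fun i => algebraMap (MvPolynomial (Fin n) κ) F (MvPolynomial.X i)).det ≠ 0 := by
    have h1 := (((U.map (algebraMap Q κ)).map MvPolynomial.C).det_powMatrix_map
      (algebraMap (MvPolynomial (Fin n) κ) F) MvPolynomial.X)
    rw [AlgStr.map_map, AlgStr.map_map] at h1
    rw [RingHom.comp_assoc] at h1
    rw [h1, map_ne_zero_iff _ hinj]
    change (U.map (algebraMap Q κ)).genDet ≠ 0
    rw [AlgStr.mem_degEq_rank_iff, U.mem_degLE_pred_of_ker_iff (algebraMap Q κ) p
      (by ext x; rw [RingHom.mem_ker, Ideal.algebraMap_residueField_eq_zero])] at hp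
    exact hp
  change RingHom.ker π ≤ p.asIdeal
  rw [← hker]
  refine hπ.ker_le hU φ _ (IsUnit.mk0 _ hdet) ?_ (fun h => absurd trivial h)
  rintro i _ ⟨hP, rfl⟩
  rw [AlgStr.powMatrix_zero_apply, hU.map_one_apply hP]

variable (k) in
/-- The open locus has a generic point, at which the algebra is commutative. -/
theorem IsUniversal.exists_generic_point (hU : IsUniversal k U P) :
    ∃ η : PrimeSpectrum Q, closure (U.degEq n) = closure {η} ∧ η ∈ U.degEq n ∧
      ∀ i j r, U.c i j r - U.c j i r ∈ η.asIdeal := by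
  obtain ⟨π, a, hπ⟩ := hU.exists_isParam (C := fun j : Fin n => P ∧ j = 0) (J := True)
    fun hP => ⟨hP, rfl⟩
  refine ⟨paramPoint π, ?_, hπ.paramPoint_mem, fun i j r => ?_⟩
  · refine (closure_minimal (fun p hp => ?_) isClosed_closure).antisymm
      (closure_mono (Set.singleton_subset_iff.2 hπ.paramPoint_mem))
    rw [← specializes_iff_mem_closure, ← PrimeSpectrum.le_iff_specializes]
    exact hπ.paramPoint_le hU hp
  · change π _ = 0
    rw [map_sub, hπ.comm, sub_self]

theorem AlgStr.isOpen_degEq_rank (s : AlgStr n Q) : IsOpen (s.degEq n) := by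
  rw [degEq_rank_eq_compl]
  exact s.isClosed_degLE_pred.isOpen_compl

theorem IsUniversal.isIrreducible_degEq (hU : IsUniversal k U P) : IsIrreducible (U.degEq n) := by
  obtain ⟨η, hη, -, -⟩ := hU.exists_generic_point k
  rw [← isIrreducible_iff_closure, hη]
  exact isIrreducible_singleton.closure

/-- An irreducible set which meets an open set `V` lies in the closure of `V`. -/
theorem IsIrreducible.subset_closure_of_isOpen {X : Type*} [TopologicalSpace X] {Z V : Set X}
    (hZ : IsIrreducible Z) (hV : IsOpen V) (h : (Z ∩ V).Nonempty) : Z ⊆ closure V :=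
  (subset_closure_inter_of_isPreirreducible_of_isOpen hZ.2 hV h).trans
    (closure_mono Set.inter_subset_right)

theorem IsUniversal.closure_degEq_mem (hU : IsUniversal k U P) :
    closure (U.degEq n) ∈ irreducibleComponents (PrimeSpectrum Q) := by
  have hirr := hU.isIrreducible_degEq
  refine ⟨hirr.closure, fun Z hZ hle => hZ.subset_closure_of_isOpen U.isOpen_degEq_rank ?_⟩
  exact hirr.1.mono fun p hp => ⟨hle (subset_closure hp), hp⟩

open Polynomial in
/-- A point over an algebraically closed field at which the degree of algebraicity is not maximal
is a specialization of a point at which the algebra is not commutative. -/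
theorem IsUniversal.exists_noncomm_point (hU : IsUniversal k U P) {K : Type u} [Field K]
    [IsAlgClosed K] (φ : Q →+* K) (hφ : (U.map φ).genDet = 0) :
    ∃ q : PrimeSpectrum Q, q.asIdeal ≤ RingHom.ker φ ∧
      ∃ i j r, U.c i j r - U.c j i r ∉ q.asIdeal := by
  by_cases hcomm : ∀ i j, (U.map φ).c i j = (U.map φ).c j i
  · obtain ⟨t, ht0, ht1, i, j, r, hijr⟩ := (U.map φ).exists_noncomm_deformation hcomm hφ
    let _ : Algebra k K := (φ.comp (algebraMap k Q)).toAlgebra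
    obtain ⟨ψ, hψ⟩ := hU.lift K[X] t fun hP => by
      rw [ht1]
      funext r
      rw [hU.map_one_apply hP]
      split_ifs <;> simp
    let φ' : Q →ₐ[k] K := { φ with commutes' := fun _ => rfl }
    let ψ' : Q →ₐ[k] K :=
      { (evalRingHom (0 : K)).comp (ψ : Q →+* K[X]) with
        commutes' := fun c => by
          change eval 0 (ψ (algebraMap k Q c)) = _
          rw [ψ.commutes, IsScalarTower.algebraMap_apply k K K[X]]
          simp }
    have heq : φ' = ψ' := hU.algHom_ext (by
      change U.map φ = (U.map (ψ : Q →+* K[X])).map (evalRingHom 0)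
      rw [hψ, ht0])
    refine ⟨⟨RingHom.ker ψ, RingHom.ker_isPrime _⟩, fun x hx => ?_, i, j, r, fun hmem => hijr ?_⟩
    · have h1 : φ x = eval 0 (ψ x) := congrArg (fun f : Q →ₐ[k] K => f x) heq
      rw [RingHom.mem_ker, h1, (RingHom.mem_ker (f := ψ)).1 hx, eval_zero]
    · have h1 : ψ (U.c i j r - U.c j i r) = 0 := hmem
      rw [map_sub, sub_eq_zero] at h1
      rw [← hψ]
      exact h1
  · push Not at hcomm
    obtain ⟨i, j, hij⟩ := hcomm
    obtain ⟨r, hr⟩ := Function.ne_iff.1 hij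
    refine ⟨⟨RingHom.ker φ, RingHom.ker_isPrime _⟩, le_rfl, i, j, r, fun hmem => hr ?_⟩
    have h1 : φ (U.c i j r - U.c j i r) = 0 := hmem
    rw [map_sub, sub_eq_zero] at h1
    exact h1

theorem IsUniversal.exists_degLE_eq_sUnion (hU : IsUniversal k U P) :
    ∃ T ⊆ irreducibleComponents (PrimeSpectrum Q), U.degLE (n - 1) = ⋃₀ T := by
  refine ⟨{Z | Z ∈ irreducibleComponents (PrimeSpectrum Q) ∧ Z ⊆ U.degLE (n - 1)},
    fun Z hZ => hZ.1, Set.Subset.antisymm (fun x hx => ?_) (Set.sUnion_subset fun Z hZ => hZ.2)⟩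
  obtain ⟨η, hη, -, hηcomm⟩ := hU.exists_generic_point k
  let K := AlgebraicClosure x.asIdeal.ResidueField
  let φ : Q →+* K :=
    (algebraMap x.asIdeal.ResidueField K).comp (algebraMap Q x.asIdeal.ResidueField)
  have hker : x.asIdeal = RingHom.ker φ := by
    ext y
    rw [RingHom.mem_ker, RingHom.comp_apply, map_eq_zero, Ideal.algebraMap_residueField_eq_zero]
  obtain ⟨q, hqφ, i, j, r, hq⟩ :=
    hU.exists_noncomm_point φ ((U.mem_degLE_pred_of_ker_iff φ x hker).1 hx)
  have hqx : q ⤳ x := (PrimeSpectrum.le_iff_specializes q x).1 (hqφ.trans hker.ge)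
  refine ⟨irreducibleComponent q,
    ⟨irreducibleComponent_mem_irreducibleComponents q, ?_⟩,
    hqx.mem_closed isClosed_irreducibleComponent mem_irreducibleComponent⟩
  intro p hp
  by_contra hp'
  -- commutators vanish at the generic point of the closure, hence not all components meet the
  -- open locus
  have hsub := isIrreducible_irreducibleComponent.subset_closure_of_isOpen U.isOpen_degEq_rank
    ⟨p, hp, (U.mem_degEq_rank_iff p).2 hp'⟩
  have hηq : η ≤ q := by
    rw [PrimeSpectrum.le_iff_specializes, specializes_iff_mem_closure, ← hη]
    exact hsub mem_irreducibleComponent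
  exact hq (hηq (hηcomm i j r))

end Locus

/-! ### The dimension of the locus -/

section Slice

variable {k : Type u} [Field k] {n : ℕ} {Q : Type u} [CommRing Q] [Algebra k Q]
  {U : AlgStr n Q} {P : Prop}

/-- The coordinates of the second basis vector `e_2`, or zero if `n = 1`. -/
def sliceVec (n : ℕ) (R : Type*) [CommRing R] : Fin n → R := fun i => if (i : ℕ) = 1 then 1 else 0

theorem map_sliceVec {R S : Type*} [CommRing R] [CommRing S] (φ : R →+* S) :
    (fun i => φ (sliceVec n R i)) = sliceVec n S := by
  funext i
  simp [sliceVec, apply_ite φ]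

theorem sliceVec_eq_zero {R : Type*} [CommRing R] (h : ¬ 2 ≤ n) : sliceVec n R = 0 := by
  funext i
  have : (i : ℕ) ≠ 1 := by omega
  simp [sliceVec, this]

variable [NeZero n]

/-- The columns which are fixed in the parametrization of the algebras generated by `e_2`, with
`e_1 = 1` if `P` holds. -/
abbrev sliceCol (n : ℕ) [NeZero n] (P : Prop) : Fin n → Prop :=
  fun j => (P ∧ j = 0) ∨ (j : ℕ) = 1

theorem eq_one_of_not_two_le (h : ¬ 2 ≤ n) : n = 1 := by
  have := NeZero.ne n
  omega

/-- In the parametrization of the algebras generated by `e_2`, the generator is `e_2`. For `n = 1`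
the generator is zero. -/
theorem IsParam.eq_sliceVec {π : Q →ₐ[k] ParamRing k (sliceCol n P) (2 ≤ n)}
    {a : Fin n → ParamRing k (sliceCol n P) (2 ≤ n)} (hπ : IsParam U (sliceCol n P) (2 ≤ n) π a) :
    a = sliceVec n _ := by
  by_cases h : 2 ≤ n
  · funext i
    have h1 := congrFun (congrFun hπ.powMatrix_eq i) ⟨1, h⟩
    rw [AlgStr.powMatrix_apply, AlgStr.powCoord_one, Matrix.map_apply,
      paramMatrix_apply_of (Or.inr rfl)] at h1
    rw [h1, sliceVec]
    by_cases hi : (i : ℕ) = 1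
    · rw [if_pos (Fin.ext hi), if_pos hi, map_one]
    · rw [if_neg (fun h => hi (congrArg Fin.val h)), if_neg hi, map_zero]
  · have h1 := hπ.powCoord_eq
    have h2 : (fun j => algebraMap _ (ParamRing k (sliceCol n P) (2 ≤ n))
        (paramVec k (sliceCol n P) (2 ≤ n) j)) = 0 := by
      funext j
      rw [paramVec, dif_neg h, map_zero, Pi.zero_apply]
    rw [h2, Matrix.mulVec_zero] at h1
    have hn : ∀ m, m = 1 → (U.map (π : Q →+* ParamRing k (sliceCol n P) (2 ≤ n))).powCoord a m = 0 →
        a = 0 := by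
      rintro _ rfl h
      rwa [AlgStr.powCoord_one] at h
    rw [hn n (eq_one_of_not_two_le h) h1, sliceVec_eq_zero h]

theorem IsParam.map_det_sliceVec {π : Q →ₐ[k] ParamRing k (sliceCol n P) (2 ≤ n)}
    {a : Fin n → ParamRing k (sliceCol n P) (2 ≤ n)} (hπ : IsParam U (sliceCol n P) (2 ≤ n) π a) :
    IsUnit (π (U.powMatrix (sliceVec n Q)).det) := by
  have h1 := hπ.isUnit_det
  rw [hπ.eq_sliceVec, ← map_sliceVec (π : Q →+* ParamRing k (sliceCol n P) (2 ≤ n)),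
    AlgStr.det_powMatrix_map] at h1
  exact h1

/-- The algebras generated by `e_2` contain the generic point of the locus. -/
theorem IsParam.closure_degEq_eq (hU : IsUniversal k U P)
    {π : Q →ₐ[k] ParamRing k (sliceCol n P) (2 ≤ n)}
    {a : Fin n → ParamRing k (sliceCol n P) (2 ≤ n)} (hπ : IsParam U (sliceCol n P) (2 ≤ n) π a) :
    closure (U.degEq n) = closure {paramPoint π} := by
  obtain ⟨η, hη, -, -⟩ := hU.exists_generic_point k
  have hle : η ≤ paramPoint π := by
    rw [PrimeSpectrum.le_iff_specializes, specializes_iff_mem_closure, ← hη]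
    exact subset_closure hπ.paramPoint_mem
  have hge : paramPoint π ≤ η := by
    let φ : Q →+* η.asIdeal.ResidueField := algebraMap _ _
    have hker : RingHom.ker φ = η.asIdeal := by
      ext x
      rw [RingHom.mem_ker, Ideal.algebraMap_residueField_eq_zero]
    change RingHom.ker π ≤ η.asIdeal
    rw [← hker]
    refine hπ.ker_le hU φ (sliceVec n _) ?_ ?_ ?_
    · rw [← map_sliceVec φ, AlgStr.det_powMatrix_map, isUnit_iff_ne_zero]
      intro h0
      have h1 : (U.powMatrix (sliceVec n Q)).det ∈ RingHom.ker φ := h0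
      rw [hker] at h1
      have h2 : π (U.powMatrix (sliceVec n Q)).det = 0 := hle h1
      exact hπ.map_det_sliceVec.ne_zero h2
    · rintro i j (⟨hP, rfl⟩ | hj)
      · rw [AlgStr.powMatrix_zero_apply, hU.map_one_apply hP]
      · rw [AlgStr.powMatrix_apply, hj, AlgStr.powCoord_one, sliceVec]
        by_cases hi : (i : ℕ) = 1
        · rw [if_pos hi, if_pos (Fin.ext (hi.trans hj.symm))]
        · rw [if_neg hi, if_neg (fun h => hi ((congrArg Fin.val h).trans hj))]
    · intro h
      have h1 : ∀ m, m = 1 → (U.map φ).powCoord (sliceVec n η.asIdeal.ResidueField) m =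
          sliceVec n η.asIdeal.ResidueField := by
        rintro _ rfl
        rw [AlgStr.powCoord_one]
      rw [h1 n (eq_one_of_not_two_le h), sliceVec_eq_zero h]
  rw [hη, le_antisymm hle hge]

/-- The parameter space of the algebras generated by `e_2` is a closed subscheme of the basic open
set of the base on which `e_2` is a generator. -/
theorem IsParam.lift_surjective {π : Q →ₐ[k] ParamRing k (sliceCol n P) (2 ≤ n)}
    {a : Fin n → ParamRing k (sliceCol n P) (2 ≤ n)} (hπ : IsParam U (sliceCol n P) (2 ≤ n) π a) :
    Function.Surjective (IsLocalization.Away.lift (S := Localization.Away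
      (U.powMatrix (sliceVec n Q)).det) _ (g := π.toRingHom) hπ.map_det_sliceVec) := by
  set δ := (U.powMatrix (sliceVec n Q)).det with hδ
  set g : Localization.Away δ →+* ParamRing k (sliceCol n P) (2 ≤ n) :=
    IsLocalization.Away.lift _ (g := π.toRingHom) hπ.map_det_sliceVec with hg
  have hgalg : ∀ q, g (algebraMap Q _ q) = π q := IsLocalization.Away.lift_eq _ _
  -- the power matrix of `e_2` over the localization of the base, and the relation it satisfies
  set H := (U.map (algebraMap Q (Localization.Away δ))).powMatrix (sliceVec n _) with hH
  have hHdet : IsUnit H.det := by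
    rw [hH, ← map_sliceVec (algebraMap Q (Localization.Away δ)), AlgStr.det_powMatrix_map]
    exact IsLocalization.Away.algebraMap_isUnit δ
  set v := (U.map (algebraMap Q (Localization.Away δ))).powCoord (sliceVec n _) n with hv
  have hcomp : (U.map (algebraMap Q (Localization.Away δ))).map g =
      U.map (π : Q →+* ParamRing k (sliceCol n P) (2 ≤ n)) := by
    rw [AlgStr.map_map]
    congr 1
    ext q
    exact hgalg q
  have hgH : H.map g =
      (paramMatrix k (sliceCol n P) (2 ≤ n)).map (algebraMap _ (ParamRing k _ _)) := by
    rw [hH, ← AlgStr.powMatrix_map, hcomp, map_sliceVec, ← hπ.eq_sliceVec, hπ.powMatrix_eq]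
  have hgv : (fun i => g (v i)) = ((paramMatrix k (sliceCol n P) (2 ≤ n)).map
      (algebraMap _ (ParamRing k (sliceCol n P) (2 ≤ n)))).mulVec
      fun j => algebraMap _ (ParamRing k (sliceCol n P) (2 ≤ n))
          (paramVec k (sliceCol n P) (2 ≤ n) j) := by
    rw [hv, ← AlgStr.powCoord_map, hcomp, map_sliceVec, ← hπ.eq_sliceVec, hπ.powCoord_eq]
  have hgf : ∀ j, g ((H⁻¹.mulVec v) j) =
      algebraMap _ (ParamRing k (sliceCol n P) (2 ≤ n))
          (paramVec k (sliceCol n P) (2 ≤ n) j) := by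
    have h1 : (fun j => g ((H⁻¹.mulVec v) j)) =
        fun j => algebraMap _ (ParamRing k (sliceCol n P) (2 ≤ n))
          (paramVec k (sliceCol n P) (2 ≤ n) j) := by
      refine Matrix.mulVec_injective_of_isUnit
        ((Matrix.isUnit_iff_isUnit_det _).2 isUnit_det_map_paramMatrix) ?_
      rw [← hgv, ← hgH]
      funext i
      have h2 := RingHom.map_mulVec g H (H⁻¹.mulVec v) i
      rw [Matrix.mulVec_mulVec, Matrix.mul_nonsing_inv _ hHdet, Matrix.one_mulVec] at h2
      exact h2.symm
    exact fun j => congrFun h1 j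
  have hpoly : ∀ y, ∃ x,
      g x = algebraMap (MvPolynomial (ParamVar n (sliceCol n P) (2 ≤ n)) k) _ y := by
    intro y
    induction y using MvPolynomial.induction_on with
    | C c =>
      refine ⟨algebraMap Q _ (algebraMap k Q c), ?_⟩
      rw [hgalg, π.commutes, IsScalarTower.algebraMap_apply k
        (MvPolynomial (ParamVar n (sliceCol n P) (2 ≤ n)) k)]
      rfl
    | add y z hy hz =>
      obtain ⟨y', hy⟩ := hy
      obtain ⟨z', hz⟩ := hz
      exact ⟨y' + z', by rw [map_add, hy, hz, map_add]⟩
    | mul_X y i hy =>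
      obtain ⟨y', hy⟩ := hy
      obtain ⟨z', hz⟩ : ∃ x, g x = algebraMap _ _ (MvPolynomial.X i) := by
        rcases i with ⟨⟨j, hj⟩, i⟩ | ⟨j, hj⟩
        · refine ⟨H i j, (congrFun (congrFun hgH i) j).trans ?_⟩
          rw [Matrix.map_apply, paramMatrix_apply_of_not hj]
        · refine ⟨_, (hgf j).trans ?_⟩
          rw [paramVec, dif_pos hj]
      exact ⟨y' * z', by rw [map_mul, hy, hz, map_mul]⟩
  intro z
  obtain ⟨m, y, hy⟩ := IsLocalization.Away.surj (paramMatrix k (sliceCol n P) (2 ≤ n)).det z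
  obtain ⟨y', hy'⟩ := hpoly y
  obtain ⟨u, hu⟩ := hHdet.exists_right_inv
  have hgu : algebraMap _ _ (paramMatrix k (sliceCol n P) (2 ≤ n)).det * g u = 1 := by
    rw [← det_map_paramMatrix, ← hgH, ← RingHom.mapMatrix_apply, ← RingHom.map_det, ← map_mul, hu,
      map_one]
  refine ⟨y' * u ^ m, ?_⟩
  rw [map_mul, map_pow, hy', ← hy, mul_assoc, ← mul_pow, hgu, one_pow, mul_one]

variable (n P) in
theorem natCard_paramVar_sliceCol (S : Finset (Fin n)) (hS : ∀ j, sliceCol n P j ↔ j ∈ S) :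
    Nat.card (ParamVar n (sliceCol n P) (2 ≤ n)) = (n - S.card) * n + if 2 ≤ n then n else 0 := by
  have h1 : Nat.card {j : Fin n // ¬ sliceCol n P j} = n - S.card := by
    rw [Nat.card_congr (Equiv.subtypeEquivRight fun j => not_congr (hS j)),
      Nat.card_eq_fintype_card, Fintype.card_subtype_compl]
    simp
  have h2 : Nat.card {_j : Fin n // 2 ≤ n} = if 2 ≤ n then n else 0 := by
    by_cases h : 2 ≤ n <;> simp [h]
  rw [Nat.card_sum, Nat.card_prod, Nat.card_fin, h1, h2]

variable (n P) in
theorem natCard_paramVar_sliceCol_of_not (hP : ¬ P) :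
    Nat.card (ParamVar n (sliceCol n P) (2 ≤ n)) = n ^ 2 := by
  by_cases h : 2 ≤ n
  · rw [natCard_paramVar_sliceCol n P {⟨1, h⟩} fun j => by
        have h1 : (j : ℕ) = 1 ↔ j = ⟨1, h⟩ := by rw [Fin.ext_iff]
        simp only [sliceCol, hP, false_and, false_or, Finset.mem_singleton, h1], if_pos h,
      Finset.card_singleton]
    obtain ⟨m, rfl⟩ := Nat.exists_eq_add_of_le h
    rw [show 2 + m - 1 = m + 1 by omega]
    ring
  · obtain rfl := eq_one_of_not_two_le h
    rw [natCard_paramVar_sliceCol 1 P ∅ fun j => by simp [hP]]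
    simp

variable (n P) in
theorem natCard_paramVar_sliceCol_of_pos (hP : P) :
    Nat.card (ParamVar n (sliceCol n P) (2 ≤ n)) = n ^ 2 - n := by
  by_cases h : 2 ≤ n
  · rw [natCard_paramVar_sliceCol n P {0, ⟨1, h⟩} fun j => by
        have h1 : (j : ℕ) = 1 ↔ j = ⟨1, h⟩ := by rw [Fin.ext_iff]
        simp only [sliceCol, hP, true_and, Finset.mem_insert, Finset.mem_singleton, h1], if_pos h,
      Finset.card_pair fun h0 => by simpa using congrArg Fin.val h0]
    obtain ⟨m, rfl⟩ := Nat.exists_eq_add_of_le h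
    refine (Nat.sub_eq_of_eq_add ?_).symm
    rw [show 2 + m - 2 = m by omega]
    ring
  · obtain rfl := eq_one_of_not_two_le h
    rw [natCard_paramVar_sliceCol 1 P {0} fun j => by
      simp [sliceCol, hP, eq_iff_true_of_subsingleton]]
    simp

theorem IsUniversal.topologicalKrullDim_degEq (hU : IsUniversal k U P) :
    topologicalKrullDim (U.degEq n) = Nat.card (ParamVar n (sliceCol n P) (2 ≤ n)) := by
  have hfin : Finite (ParamVar n (sliceCol n P) (2 ≤ n)) := inferInstance
  obtain ⟨π, a, hπ⟩ := hU.exists_isParam (C := sliceCol n P) (J := 2 ≤ n)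
    fun hP => Or.inl ⟨hP, rfl⟩
  apply le_antisymm
  · have : Algebra.FiniteType k Q := hU.finiteType
    let I : Ideal Q := RingHom.ker π
    have h1 : ringKrullDim (Q ⧸ I) ≤ Nat.card (ParamVar n (sliceCol n P) (2 ≤ n)) :=
      ringKrullDim_le_card_of_injective _ (det_paramMatrix_ne_zero k _ _) (Ideal.kerLiftAlg π)
        (Ideal.kerLiftAlg_injective π)
    rw [← PrimeSpectrum.topologicalKrullDim_eq_ringKrullDim] at h1
    refine le_trans ?_ h1
    have hemb := (PrimeSpectrum.isClosedEmbedding_comap_of_surjective (Q ⧸ I) (Ideal.Quotient.mk I)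
      Ideal.Quotient.mk_surjective).isEmbedding
    have hsub : U.degEq n ⊆ Set.range (PrimeSpectrum.comap (Ideal.Quotient.mk I)) := by
      rw [range_comap_of_surjective _ _ Ideal.Quotient.mk_surjective, Ideal.mk_ker]
      intro p hp
      have h2 := subset_closure hp
      rwa [hπ.closure_degEq_eq hU, ← specializes_iff_mem_closure,
        ← PrimeSpectrum.le_iff_specializes] at h2
    rw [IsHomeomorph.topologicalKrullDim_eq _ hemb.toHomeomorph.isHomeomorph]
    exact (Topology.IsEmbedding.inclusion hsub).isInducing.topologicalKrullDim_le
  · obtain ⟨x, hx⟩ := exists_eval_det_paramMatrix_ne_zero k (sliceCol n P) (2 ≤ n)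
    refine (card_le_ringKrullDim_localizationAway _ _ x hx).trans ?_
    rw [← PrimeSpectrum.topologicalKrullDim_eq_ringKrullDim]
    set δ := (U.powMatrix (sliceVec n Q)).det with hδ
    have h1 := (PrimeSpectrum.isClosedEmbedding_comap_of_surjective _ _
      hπ.lift_surjective).isEmbedding
    have h2 := (PrimeSpectrum.localization_away_isOpenEmbedding
      (Localization.Away δ) δ).isEmbedding.comp h1
    have h3 : ∀ p, (PrimeSpectrum.comap (algebraMap Q (Localization.Away δ)) ∘
        PrimeSpectrum.comap (IsLocalization.Away.lift δ (g := π.toRingHom)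
          hπ.map_det_sliceVec)) p ∈ U.degEq n := by
      intro p
      let φ : Q →+* ParamRing k (sliceCol n P) (2 ≤ n) ⧸ p.asIdeal :=
        (Ideal.Quotient.mk p.asIdeal).comp π
      refine U.mem_degEq_rank_of_det_ne_zero φ _ ?_ (sliceVec n _) ?_
      · ext q
        change IsLocalization.Away.lift δ (g := π.toRingHom) hπ.map_det_sliceVec
          (algebraMap Q _ q) ∈ p.asIdeal ↔ Ideal.Quotient.mk p.asIdeal (π q) = 0
        rw [IsLocalization.Away.lift_eq, Ideal.Quotient.eq_zero_iff_mem]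
        rfl
      · rw [← map_sliceVec φ, AlgStr.det_powMatrix_map]
        exact (hπ.map_det_sliceVec.map (Ideal.Quotient.mk p.asIdeal)).ne_zero
    exact (h2.isInducing.codRestrict h3).topologicalKrullDim_le

end Slice

/-! ### The two moduli schemes -/

section Moduli

variable (k : Type u) [Field k] (n : ℕ)

variable {k n} in
/-- Evaluation of polynomials in the structure constants and the coordinates of the unit. -/
noncomputable def AlgStr.evalHom {T : Type u} [CommRing T] [Algebra k T] (s : AlgStr n T) :
    MvPolynomial (AlgVar n) k →ₐ[k] T :=
  MvPolynomial.aeval (Sum.elim (fun x => s.c x.1 x.2.1 x.2.2) s.one)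

variable {k n} in
theorem AlgStr.evalHom_genC {T : Type u} [CommRing T] [Algebra k T] (s : AlgStr n T)
    (i j r : Fin n) : s.evalHom (genC k n i j r) = s.c i j r := by
  simp [evalHom, genC]

variable {k n} in
theorem AlgStr.evalHom_genOne {T : Type u} [CommRing T] [Algebra k T] (s : AlgStr n T)
    (r : Fin n) : s.evalHom (genOne k n r) = s.one r := by
  simp [evalHom, genOne]

theorem AlgStr.evalHom_algRel {T : Type u} [CommRing T] [Algebra k T] (s : AlgStr n T)
    {f : MvPolynomial (AlgVar n) k} (hf : f ∈ algRel k n) : s.evalHom f = 0 := by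
  rcases hf with (⟨i, j, l, r, rfl⟩ | ⟨j, r, rfl⟩) | ⟨j, r, rfl⟩
  · simp only [map_sub, map_sum, map_mul, evalHom_genC, s.assoc, sub_self]
  · simp only [map_sub, map_sum, map_mul, evalHom_genC, evalHom_genOne, s.unit_mul]
    split_ifs <;> simp
  · simp only [map_sub, map_sum, map_mul, evalHom_genC, evalHom_genOne, s.mul_unit]
    split_ifs <;> simp

/-- The tautological algebra over a quotient by `I` is universal as soon as `I` is killed by the
evaluation at every algebra which satisfies the condition expressed by `P`. -/
theorem isUniversal_tautStr [NeZero n] (I : Ideal (MvPolynomial (AlgVar n) k)) (hI : algRel k n ⊆ I)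
    (P : Prop)
    (hone : P → ∀ r, genOne k n r - (if r = 0 then 1 else 0) ∈ I)
    (hlift : ∀ (T : Type u) [CommRing T] [Algebra k T] (s : AlgStr n T),
      (P → s.one = fun r => if r = 0 then 1 else 0) → ∀ f ∈ I, s.evalHom (k := k) f = 0) :
    IsUniversal k (tautStr k n I hI) P where
  one_eq hP := by
    funext r
    have h1 := Ideal.Quotient.eq.2 (hone hP r)
    change Ideal.Quotient.mk I (genOne k n r) = _
    rw [h1]
    split_ifs <;> simp
  lift T _ _ s hs := by
    refine ⟨Ideal.Quotient.liftₐ I s.evalHom (hlift T s hs), AlgStr.eq_of_c_eq_of_one_eq ?_ ?_⟩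
    · funext i j r
      exact s.evalHom_genC i j r
    · funext r
      exact s.evalHom_genOne r
  adjoin_eq_top := by
    have h1 : Algebra.adjoin k (Ideal.Quotient.mkₐ k I '' Set.range MvPolynomial.X) = ⊤ := by
      rw [← AlgHom.map_adjoin, MvPolynomial.adjoin_range_X, Algebra.map_top,
        AlgHom.range_eq_top]
      exact Ideal.Quotient.mkₐ_surjective k I
    rw [← top_le_iff, ← h1]
    refine Algebra.adjoin_mono ?_
    rintro _ ⟨_, ⟨v | r, rfl⟩, rfl⟩
    · exact Or.inl ⟨v, rfl⟩
    · exact Or.inr ⟨r, rfl⟩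

theorem isUniversal_basedUniv [NeZero n] : IsUniversal k (basedUniv k n) False := by
  refine isUniversal_tautStr k n _ _ _ (fun h => h.elim) fun T _ _ s _ f hf => ?_
  have hle : Ideal.span (algRel k n) ≤ RingHom.ker s.evalHom :=
    Ideal.span_le.2 fun g hg => s.evalHom_algRel k n hg
  exact hle hf

theorem isUniversal_pointedUniv [NeZero n] : IsUniversal k (pointedUniv k n) True := by
  refine isUniversal_tautStr k n _ _ _
    (fun _ r => Ideal.subset_span (Or.inr ⟨r, rfl⟩)) fun T _ _ s hs f hf => ?_
  have hle : Ideal.span (algRel k n ∪ firstRel k n) ≤ RingHom.ker s.evalHom := by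
    refine Ideal.span_le.2 ?_
    rintro g (hg | ⟨r, rfl⟩)
    · exact s.evalHom_algRel k n hg
    · change s.evalHom _ = 0
      rw [map_sub, AlgStr.evalHom_genOne, hs trivial]
      by_cases h : r = 0 <;> simp [h]
  exact hle hf

end Moduli

theorem mainTheorem8 (k : Type u) [Field k] (n : ℕ) [NeZero n] :
    (IsIrreducible ((basedUniv k n).degEq n) ∧
      topologicalKrullDim ((basedUniv k n).degEq n) = ((n ^ 2 : ℕ) : WithBot ℕ∞) ∧
      closure ((basedUniv k n).degEq n) ∈ irreducibleComponents (PrimeSpectrum (BasedAlgRing k n)) ∧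
      ∃ T ⊆ irreducibleComponents (PrimeSpectrum (BasedAlgRing k n)),
        (basedUniv k n).degLE (n - 1) = ⋃₀ T) ∧
    (IsIrreducible ((pointedUniv k n).degEq n) ∧
      topologicalKrullDim ((pointedUniv k n).degEq n) = ((n ^ 2 - n : ℕ) : WithBot ℕ∞) ∧
      closure ((pointedUniv k n).degEq n) ∈
        irreducibleComponents (PrimeSpectrum (PointedAlgRing k n)) ∧
      ∃ T ⊆ irreducibleComponents (PrimeSpectrum (PointedAlgRing k n)),
        (pointedUniv k n).degLE (n - 1) = ⋃₀ T) := by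
  have hb := isUniversal_basedUniv k n
  have hp := isUniversal_pointedUniv k n
  refine ⟨⟨hb.isIrreducible_degEq, ?_, hb.closure_degEq_mem, hb.exists_degLE_eq_sUnion⟩,
    ⟨hp.isIrreducible_degEq, ?_, hp.closure_degEq_mem, hp.exists_degLE_eq_sUnion⟩⟩
  · rw [hb.topologicalKrullDim_degEq, natCard_paramVar_sliceCol_of_not n False not_false]
  · rw [hp.topologicalKrullDim_degEq, natCard_paramVar_sliceCol_of_pos n True trivial]
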